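/- Let $\sigma_3=\begin{bmatrix}1&0\\0&-1\end{bmatrix}$, $\breve J=\begin{bmatrix}0&1\\-1&0\end{bmatrix}$, $q_1=-\breve J$, let $0<l<\infty$, and consider on $(0,l)$ the radial Dirac system $$\Big(\frac{d}{dx}+\lambda q_1+q_0(x)\Big)u(x,\lambda)=0,\qquad q_0(x)=\Big(\frac{\kappa_0}{x}+v_a(x)\Big)\sigma_3+\breve J\big(v_e(x)I_2+v_s(x)\sigma_3\big),$$ where $\kappa_0\in\mathbb Z$ and $v_a,v_e,v_s$ are real-valued and locally integrable on $[0,l)$. Differential equations are understood for locally absolutely continuous functions, almost everywhere. Suppose that $q_0$ is bounded on $(0,\varepsilon)$ for some $\varepsilon>0$. Let $m\ge 0$, $\varkappa\ge 1$, let $\mathcal A_1,\mathcal S_1$ be complex $m\times m$ matrices with $\mathcal S_1>0$, $\mathcal A_2$ a complex lower triangular $\varkappa\times\varkappa$ matrix, and $\Psi_1$, $\Psi_2$ complex $m\times2$ and $\varkappa\times2$ matrices such that $$\mathcal A_1\mathcal S_1-\mathcal S_1\mathcal A_1^*=\Psi_1\breve J\Psi_1^*,\qquad \Psi_2\breve J\Psi_2^*=0,$$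 and such that the first row $h$ of $\Psi_2$ equals $c[1\ \ 0]$ or $c[0\ \ 1]$ for some $c\neq0$. Put $$A=\begin{bmatrix}\mathcal A_1&0\\R&\mathcal A_2\end{bmatrix},\quad R=\Psi_2\breve J\Psi_1^*\mathcal S_1^{-1},\quad S(0)=\begin{bmatrix}\mathcal S_1&0\\0&0\end{bmatrix},\quad \Pi(0)=\begin{bmatrix}\Psi_1\\\Psi_2\end{bmatrix},$$ and let $\Pi$ and $S$ be the solutions on $[0,l)$, with these initial values, of $$\Pi_x=A\Pi q_1+\Pi q_0,\qquad S_x=\Pi\Pi^*.$$ Assume that $S(x)>0$ for $0<x<l$. Define $$X=\Pi^*S^{-1}\Pi,\qquad \widetilde q_0=q_0+\breve JX\breve J^*-X,\qquad w_A(x,\lambda)=I_2-\breve J\,\Pi(x)^*S(x)^{-1}(A-\lambda I)^{-1}\Pi(x).$$ Then: 1. For every $\lambda\in\mathbb C$ with $\lambda\notin\sigma(A)\cup\sigma(A^*)$ and every fundamental (that is, non-degenerate $2\times2$ matrix) solution $u$ of the initial system on $(0,l)$, the function $\widetilde u=w_Au$ is a fundamental solution on $(0,l)$ of the transformed system $$\Big(\frac{d}{dx}+\lambda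 q_1+\widetilde q_0(x)\Big)\widetilde u(x,\lambda)=0.$$ 2. One has $$\widetilde q_0(x)=\frac{\kappa}{x}\sigma_3+\Upsilon(x),$$ where $\Upsilon$ is bounded on $(0,\varepsilon)$ for some $\varepsilon>0$. Here $\kappa=\varkappa$ if $\varkappa$ is odd and $h=c[0\ \ 1]$, or if $\varkappa$ is even and $h=c[1\ \ 0]$; and $\kappa=-\varkappa$ if $\varkappa$ is even and $h=c[0\ \ 1]$, or if $\varkappa$ is odd and $h=c[1\ \ 0]$. -/

import Mathlib

open scoped ComplexOrder

noncomputable section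

namespace RadialDirac

/-- The Pauli matrix `σ₃`. -/
def pauli3 : Matrix (Fin 2) (Fin 2) ℂ := !![1, 0; 0, -1]

/-- The matrix `J̆ = (-i σ₂)⁻¹`. -/
def brevJ : Matrix (Fin 2) (Fin 2) ℂ := !![0, 1; -1, 0]

/-- The coefficient `q₁ = -J̆` of the spectral parameter. -/
def q1 : Matrix (Fin 2) (Fin 2) ℂ := -brevJ

/-- `q₀(x) = (κ/x + v_a(x)) σ₃ + J̆ (v_e(x) I₂ + v_s(x) σ₃)`, the coefficient of the radial Dirac
system with integer `κ` and real potentials `v_a`, `v_e`, `v_s`. -/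
def diracQ0 (κ : ℤ) (va ve vs : ℝ → ℝ) (x : ℝ) : Matrix (Fin 2) (Fin 2) ℂ :=
  (((κ : ℝ) / x + va x : ℝ) : ℂ) • pauli3
    + brevJ * (((ve x : ℝ) : ℂ) • (1 : Matrix (Fin 2) (Fin 2) ℂ) + ((vs x : ℝ) : ℂ) • pauli3)

/-- `Y` is locally absolutely continuous on the interval `I` and `dY/dx = F` almost everywhere on
`I` (entry by entry).  This is the usual (Carathéodory) meaning of a differential equation with
locally integrable coefficients. -/
def HasACDerivOn {α β : Type*} (I : Set ℝ) (Y F : ℝ → Matrix α β ℂ) : Prop :=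
  (∀ i j, ∀ a ∈ I, ∀ b ∈ I, AbsolutelyContinuousOnInterval (fun x => Y x i j) a b) ∧
    ∀ i j, ∀ᵐ x ∂(MeasureTheory.volume.restrict I), HasDerivAt (fun t => Y t i j) (F x i j) x

/-- `u` is a fundamental solution on `(0, l)` of `(d/dx + lam q₁ + q₀(x)) u = 0`: a `2 × 2` matrix
solution which is non-degenerate. -/
def IsFundamentalSolution (l : ℝ) (q0 : ℝ → Matrix (Fin 2) (Fin 2) ℂ) (lam : ℂ)
    (u : ℝ → Matrix (Fin 2) (Fin 2) ℂ) : Prop :=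
  HasACDerivOn (Set.Ioo 0 l) u (fun x => -((lam • q1 + q0 x) * u x)) ∧
    ∀ x ∈ Set.Ioo 0 l, (u x).det ≠ 0

/-- The matrix function `X = Π* S⁻¹ Π`. -/
def matX {α : Type*} [Fintype α] [DecidableEq α] (P : ℝ → Matrix α (Fin 2) ℂ)
    (S : ℝ → Matrix α α ℂ) (x : ℝ) : Matrix (Fin 2) (Fin 2) ℂ :=
  (P x).conjTranspose * (S x)⁻¹ * P x

/-- The transformed coefficient `q₀ + J̆ X J̆* - X`. -/
def transformedQ0 {α : Type*} [Fintype α] [DecidableEq α]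
    (q0 : ℝ → Matrix (Fin 2) (Fin 2) ℂ) (P : ℝ → Matrix α (Fin 2) ℂ)
    (S : ℝ → Matrix α α ℂ) (x : ℝ) : Matrix (Fin 2) (Fin 2) ℂ :=
  q0 x + brevJ * matX P S x * brevJ.conjTranspose - matX P S x

/-- The transfer matrix function `w_A(x, lam) = I₂ - J̆ Π* S⁻¹ (A - lam I)⁻¹ Π`. -/
def transferW {α : Type*} [Fintype α] [DecidableEq α] (A : Matrix α α ℂ)
    (P : ℝ → Matrix α (Fin 2) ℂ) (S : ℝ → Matrix α α ℂ) (lam : ℂ) (x : ℝ) :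
    Matrix (Fin 2) (Fin 2) ℂ :=
  1 - brevJ * (P x).conjTranspose * (S x)⁻¹ * (A - lam • (1 : Matrix α α ℂ))⁻¹ * P x

/-- `M` is bounded on some interval `(0, ε)`, `ε > 0`. -/
def BoundedNearZero (M : ℝ → Matrix (Fin 2) (Fin 2) ℂ) : Prop :=
  ∃ ε : ℝ, 0 < ε ∧ ∃ C : ℝ, ∀ x ∈ Set.Ioo 0 ε, ∀ i j, ‖M x i j‖ ≤ C

end RadialDirac

end

namespace RadialDirac

open Set Filter Topology MeasureTheory Asymptotics

/-! ### Absolutely continuous functions -/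

/-! The first claim rests on the identity `A S - S A* = Π J̆ Π*`. It holds at `0` by the choice of
`R` and is preserved by the flow, because `q₀ J̆ + J̆ q₀* = 0`. Together with the resolvent
identities for `(A - λ)⁻¹` it turns the derivative of the transfer function into `w' = -(λ q₁ + q̃₀)
w + w (λ q₁ + q₀)` (`darboux_deriv_identity`), so `w u` solves the new system. By Sylvester's
determinant identity, `det w = det (A* - λ) / det (A - λ)`, which is nonzero off the two spectra.

For the second claim, `Ψ₂ J̆ Ψ₂* = 0` and the form of one row force `Ψ₂ = ψ h` with `h` a coordinate
row, so `R` also has the form `ψ r`. Positivity of `S` makes the pair `(A₂, ψ)` controllable: a left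
eigenvector of `A₂` killing `ψ` would annihilate `Π`, hence `S`, near `0` (`krylov_det_ne_zero`). In
the Krylov basis `ψ, A₂ ψ, A₂² ψ, …` the singular rows of `Π` form a chain, and the `k`-th is `x ^ k
h q₁ ^ k / k!` up to `O(x ^ (k + 1))`. Write `V` for the matrix of rows `h q₁ ^ k / k!`. Integrating
`Π Π*` gives the singular block of `S` the leading entries `x ^ (j + k + 1) H j k`, where `H j k =
(V V*) j k / (j + k + 1)`. Rescaling by powers of `x` yields `x X(x) = V* H⁻¹ V + O(x)`
(`isBigO_mul_gram_sub`), so `X` equals `x⁻¹ V* H⁻¹ V` up to a bounded term.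

It remains to evaluate `J̆ M J̆* - M` for `M = V* H⁻¹ V`. The rows of `V` are alternately
eigenvectors of `σ₃` for `s` and `-s`, where `h σ₃ = s h`. Hence `M` is diagonal and the difference
is `-tr(σ₃ M) σ₃`. With `N = diag(2k + 1)` one has `N H + H N = 2 V V*`, and the trace collapses to
`s ∑ (-1) ^ k (2k + 1) = -s (-1) ^ n n` (`brevJ_conj_sub_of_gram`). This is the integer `κ = s (-1)
^ n n`. -/

theorem acOn_of_dist_le {X Y : Type*} [PseudoMetricSpace X] [PseudoMetricSpace Y] {f : ℝ → X}
    {g : ℝ → Y} {a b K : ℝ} (hf : AbsolutelyContinuousOnInterval f a b)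
    (h : ∀ x ∈ uIcc a b, ∀ y ∈ uIcc a b, dist (g x) (g y) ≤ K * dist (f x) (f y)) :
    AbsolutelyContinuousOnInterval g a b := by
  have hK := Tendsto.const_mul (|K|) hf
  rw [mul_zero] at hK
  refine squeeze_zero' (Eventually.of_forall fun E => Finset.sum_nonneg fun _ _ => dist_nonneg)
    ?_ hK
  filter_upwards [mem_inf_of_right (mem_principal_self _)] with E hE
  rw [Finset.mul_sum]
  refine Finset.sum_le_sum fun i hi => ?_
  have := hE.1 i hi
  refine (h _ this.1 _ this.2).trans ?_
  exact mul_le_mul_of_nonneg_right (le_abs_self K) dist_nonneg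

theorem acOn_const {X : Type*} [PseudoMetricSpace X] (c : X) (a b : ℝ) :
    AbsolutelyContinuousOnInterval (fun _ : ℝ => c) a b :=
  (LipschitzOnWith.absolutelyContinuousOnInterval (K := 0)
    (fun x _ y _ => by simp))

theorem acOn_mul {f g : ℝ → ℂ} {a b : ℝ} (hf : AbsolutelyContinuousOnInterval f a b)
    (hg : AbsolutelyContinuousOnInterval g a b) :
    AbsolutelyContinuousOnInterval (fun x => f x * g x) a b :=
  AbsolutelyContinuousOnInterval.smul (F := ℂ) (M := ℂ) (f := f) (g := g) hf hg

theorem acOn_sum {ι : Type*} (s : Finset ι) {f : ι → ℝ → ℂ} {a b : ℝ}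
    (hf : ∀ i ∈ s, AbsolutelyContinuousOnInterval (f i) a b) :
    AbsolutelyContinuousOnInterval (fun x => ∑ i ∈ s, f i x) a b := by
  classical
  induction s using Finset.induction_on with
  | empty => simpa using acOn_const (0 : ℂ) a b
  | insert i s hi ih =>
    simp only [Finset.sum_insert hi]
    exact (hf i (Finset.mem_insert_self _ _)).fun_add
      (ih fun j hj => hf j (Finset.mem_insert_of_mem hj))

theorem acOn_prod {ι : Type*} (s : Finset ι) {f : ι → ℝ → ℂ} {a b : ℝ}
    (hf : ∀ i ∈ s, AbsolutelyContinuousOnInterval (f i) a b) :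
    AbsolutelyContinuousOnInterval (fun x => ∏ i ∈ s, f i x) a b := by
  classical
  induction s using Finset.induction_on with
  | empty => simpa using acOn_const (1 : ℂ) a b
  | insert i s hi ih =>
    simp only [Finset.prod_insert hi]
    exact acOn_mul (hf i (Finset.mem_insert_self _ _))
      (ih fun j hj => hf j (Finset.mem_insert_of_mem hj))

theorem acOn_inv {f : ℝ → ℂ} {a b : ℝ} (hf : AbsolutelyContinuousOnInterval f a b)
    (h0 : ∀ x ∈ uIcc a b, f x ≠ 0) :
    AbsolutelyContinuousOnInterval (fun x => (f x)⁻¹) a b := by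
  obtain ⟨C, hC⟩ := isCompact_uIcc.exists_bound_of_continuousOn (hf.continuousOn.inv₀ h0)
  refine acOn_of_dist_le (K := C * C) hf fun x hx y hy => ?_
  have hC0 : 0 ≤ C := (norm_nonneg _).trans (hC x hx)
  rw [dist_eq_norm, dist_comm, dist_eq_norm, inv_sub_inv (h0 x hx) (h0 y hy),
    div_eq_mul_inv, mul_inv, norm_mul, norm_mul, mul_comm]
  gcongr
  · exact hC x hx
  · exact hC y hy

theorem acOn_det {α : Type*} [Fintype α] [DecidableEq α] {Y : ℝ → Matrix α α ℂ} {a b : ℝ}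
    (h : ∀ i j, AbsolutelyContinuousOnInterval (fun x => Y x i j) a b) :
    AbsolutelyContinuousOnInterval (fun x => (Y x).det) a b := by
  simp only [Matrix.det_apply']
  exact acOn_sum _ fun σ _ => acOn_mul (acOn_const _ a b) (acOn_prod _ fun i _ => h _ _)

theorem differentiableAt_det {α : Type*} [Fintype α] [DecidableEq α] {Y : ℝ → Matrix α α ℂ}
    {x : ℝ} (h : ∀ i j, DifferentiableAt ℝ (fun t => Y t i j) x) :
    DifferentiableAt ℝ (fun t => (Y t).det) x := by
  simp only [Matrix.det_apply']
  fun_prop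

/-- Multiplying by the unimodular `z` that makes the increment real and nonnegative, and taking real
parts, reduces to the fundamental theorem of calculus for a real absolutely continuous function. -/
theorem norm_sub_le_of_ae_norm_deriv_le {f F : ℝ → ℂ} {a b C : ℝ} (hab : a ≤ b)
    (hf : AbsolutelyContinuousOnInterval f a b)
    (hd : ∀ᵐ x, x ∈ Ioo a b → HasDerivAt f (F x) x) (hF : ∀ x ∈ Ioo a b, ‖F x‖ ≤ C) :
    ‖f b - f a‖ ≤ C * (b - a) := by
  obtain ⟨z, hz, hzn⟩ : ∃ z : ℂ, ‖z‖ = 1 ∧ z * (f b - f a) = ‖f b - f a‖ := by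
    by_cases h : f b - f a = 0
    · exact ⟨1, by simp, by simp [h]⟩
    · refine ⟨‖f b - f a‖ / (f b - f a), ?_, div_mul_cancel₀ _ h⟩
      rw [norm_div, Complex.norm_real, norm_norm, div_self (norm_ne_zero_iff.2 h)]
  have hg : AbsolutelyContinuousOnInterval (fun x => (z * f x).re) a b := by
    refine acOn_of_dist_le (K := 1) hf fun x _ y _ => ?_
    rw [one_mul, dist_eq_norm, dist_eq_norm, ← Complex.sub_re, ← mul_sub]
    refine (Complex.abs_re_le_norm _).trans ?_
    rw [norm_mul, hz, one_mul]
  have hint := hg.integral_deriv_eq_sub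
  have hval : (z * f b).re - (z * f a).re = ‖f b - f a‖ := by
    rw [← Complex.sub_re, ← mul_sub, hzn, Complex.ofReal_re]
  have hb : ‖∫ x in a..b, deriv (fun x => (z * f x).re) x‖ ≤ C * |b - a| := by
    refine intervalIntegral.norm_integral_le_of_norm_le_const_ae ?_
    have hne : ∀ᵐ x : ℝ, x ≠ b := by simp [ae_iff]
    filter_upwards [hd, hne] with x hx hxb hmem
    rw [uIoc_of_le hab] at hmem
    have hxm : x ∈ Ioo a b := ⟨hmem.1, lt_of_le_of_ne hmem.2 hxb⟩
    have h1 : HasDerivAt (fun x => (z * f x).re) (z * F x).re x :=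
      Complex.reCLM.hasFDerivAt.comp_hasDerivAt x ((hx hxm).const_mul z)
    rw [h1.deriv]
    refine (Complex.abs_re_le_norm _).trans ?_
    rw [norm_mul, hz, one_mul]
    exact hF x hxm
  rw [hint, hval, norm_norm, abs_of_nonneg (sub_nonneg.2 hab)] at hb
  exact hb

/-! ### Scalar Carathéodory derivatives -/

/-- Scalar version of `HasACDerivOn`. -/
def HasACDeriv (I : Set ℝ) (f F : ℝ → ℂ) : Prop :=
  (∀ a ∈ I, ∀ b ∈ I, AbsolutelyContinuousOnInterval f a b) ∧
    ∀ᵐ x ∂(volume.restrict I), HasDerivAt f (F x) x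

theorem hasACDerivOn_iff {α β : Type*} {I : Set ℝ} {Y F : ℝ → Matrix α β ℂ} :
    HasACDerivOn I Y F ↔ ∀ i j, HasACDeriv I (fun x => Y x i j) (fun x => F x i j) :=
  ⟨fun h i j => ⟨h.1 i j, h.2 i j⟩, fun h => ⟨fun i j => (h i j).1, fun i j => (h i j).2⟩⟩

namespace HasACDeriv

variable {I : Set ℝ} {f g F G : ℝ → ℂ}

theorem const (I : Set ℝ) (c : ℂ) : HasACDeriv I (fun _ => c) (fun _ => 0) :=
  ⟨fun a _ b _ => acOn_const c a b, Eventually.of_forall fun x => hasDerivAt_const x c⟩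

theorem sub (hf : HasACDeriv I f F) (hg : HasACDeriv I g G) :
    HasACDeriv I (fun x => f x - g x) (fun x => F x - G x) :=
  ⟨fun a ha b hb => (hf.1 a ha b hb).fun_sub (hg.1 a ha b hb), by
    filter_upwards [hf.2, hg.2] with x h1 h2 using h1.sub h2⟩

theorem mul (hf : HasACDeriv I f F) (hg : HasACDeriv I g G) :
    HasACDeriv I (fun x => f x * g x) (fun x => F x * g x + f x * G x) :=
  ⟨fun a ha b hb => acOn_mul (hf.1 a ha b hb) (hg.1 a ha b hb), by
    filter_upwards [hf.2, hg.2] with x h1 h2 using h1.mul h2⟩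

theorem sum {ι : Type*} (s : Finset ι) {f F : ι → ℝ → ℂ} (h : ∀ i ∈ s, HasACDeriv I (f i) (F i)) :
    HasACDeriv I (fun x => ∑ i ∈ s, f i x) (fun x => ∑ i ∈ s, F i x) :=
  ⟨fun a ha b hb => acOn_sum s fun i hi => (h i hi).1 a ha b hb, by
    have : ∀ᵐ x ∂(volume.restrict I), ∀ i ∈ s, HasDerivAt (f i) (F i x) x :=
      (ae_ball_iff s.countable_toSet).2 fun i hi => (h i hi).2
    filter_upwards [this] with x hx using HasDerivAt.fun_sum hx⟩

theorem star (hf : HasACDeriv I f F) :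
    HasACDeriv I (fun x => star (f x)) (fun x => star (F x)) :=
  ⟨fun a ha b hb => acOn_of_dist_le (K := 1) (hf.1 a ha b hb) fun x _ y _ => by
      rw [one_mul, dist_star_star], by
    filter_upwards [hf.2] with x hx using hx.star⟩

theorem pow (I : Set ℝ) (c : ℂ) (k : ℕ) :
    HasACDeriv I (fun x => c * (x : ℂ) ^ (k + 1) / (k + 1)) (fun x => c * (x : ℂ) ^ k) := by
  have hd : ∀ x : ℝ, HasDerivAt (fun x : ℝ => c * (x : ℂ) ^ (k + 1) / (k + 1)) (c * (x : ℂ) ^ k) x := by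
    intro x
    have h1 : HasDerivAt (fun z : ℂ => c * z ^ (k + 1) / (k + 1)) (c * (x : ℂ) ^ k) (x : ℂ) := by
      have := ((hasDerivAt_pow (k + 1) (x : ℂ)).const_mul c).div_const ((k : ℂ) + 1)
      refine this.congr_deriv ?_
      have : (k : ℂ) + 1 ≠ 0 := by exact_mod_cast Nat.succ_ne_zero k
      push_cast
      field_simp
    exact h1.comp_ofReal
  refine ⟨fun a _ b _ => ?_, Eventually.of_forall hd⟩
  refine ContDiffOn.absolutelyContinuousOnInterval (ContDiff.contDiffOn ?_)
  have : ContDiff ℝ 1 (fun x : ℝ => (x : ℂ)) := Complex.ofRealCLM.contDiff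
  fun_prop

theorem congr_deriv (hf : HasACDeriv I f F) (h : ∀ x ∈ I, F x = G x) (hI : MeasurableSet I) :
    HasACDeriv I f G :=
  ⟨hf.1, by
    filter_upwards [hf.2, ae_restrict_mem hI] with x hx hm using h x hm ▸ hx⟩

/-- Each integration from a zero initial value gains one power of `x`. All the expansions at `0` are
produced this way. -/
theorem isBigO {l : ℝ} (hl : 0 < l) (hf : HasACDeriv (Ico 0 l) f F) (h0 : f 0 = 0) {k : ℕ}
    (hF : F =O[𝓝[>] 0] fun x : ℝ => x ^ k) : f =O[𝓝[>] 0] fun x : ℝ => x ^ (k + 1) := by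
  obtain ⟨C, hC⟩ := hF.bound
  obtain ⟨ε, hε, hεs⟩ := mem_nhdsGT_iff_exists_Ioo_subset.1 hC
  refine IsBigO.of_bound (|C|) ?_
  filter_upwards [Ioo_mem_nhdsGT (lt_min hl hε)] with x hx
  have hx0 : 0 < x := hx.1
  have hxl : x < l := hx.2.trans_le (min_le_left _ _)
  have hxe : x < ε := hx.2.trans_le (min_le_right _ _)
  have := norm_sub_le_of_ae_norm_deriv_le (F := F) (C := |C| * x ^ k) hx0.le
    (hf.1 0 ⟨le_rfl, hl⟩ x ⟨hx0.le, hxl⟩) ?_ ?_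
  · rw [h0, sub_zero, sub_zero] at this
    rw [Real.norm_of_nonneg (by positivity), pow_succ, ← mul_assoc]
    exact this
  · filter_upwards [(ae_restrict_iff' measurableSet_Ico).1 hf.2] with t ht hm
    exact ht ⟨hm.1.le, hm.2.trans hxl⟩
  · intro t ht
    have h1 : ‖F t‖ ≤ C * ‖t ^ k‖ := hεs ⟨ht.1, ht.2.trans hxe⟩
    rw [Real.norm_of_nonneg (pow_nonneg ht.1.le k)] at h1
    have h2 : t ^ k ≤ x ^ k := pow_le_pow_left₀ ht.1.le ht.2.le k
    refine h1.trans ((mul_le_mul_of_nonneg_right (le_abs_self C) (pow_nonneg ht.1.le k)).trans ?_)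
    exact mul_le_mul_of_nonneg_left h2 (abs_nonneg C)

/-- Integration of an asymptotic expansion at `0`. -/
theorem isBigO_sub {l : ℝ} (hl : 0 < l) (hf : HasACDeriv (Ico 0 l) f F) (h0 : f 0 = 0) {k : ℕ}
    {c : ℂ} (hF : (fun x => F x - c * (x : ℂ) ^ k) =O[𝓝[>] 0] fun x : ℝ => x ^ (k + 1)) :
    (fun x => f x - c * (x : ℂ) ^ (k + 1) / (k + 1)) =O[𝓝[>] 0] fun x : ℝ => x ^ (k + 2) :=
  (hf.sub (pow (Ico 0 l) c k)).isBigO hl (by simp [h0]) hF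

theorem isBigO_one {l : ℝ} (hl : 0 < l) (hf : HasACDeriv (Ico 0 l) f F) :
    f =O[𝓝[>] 0] fun _ : ℝ => (1 : ℝ) := by
  obtain ⟨C, hC⟩ := (hf.1 0 ⟨le_rfl, hl⟩ (l / 2) ⟨by positivity, by linarith⟩).exists_bound
  refine IsBigO.of_bound C ?_
  filter_upwards [Ioo_mem_nhdsGT (half_pos hl)] with x hx
  simpa using hC x (by rw [uIcc_of_le (by positivity)]; exact ⟨hx.1.le, hx.2.le⟩)

theorem eq_of_deriv_zero {l : ℝ} (hl : 0 < l) (hf : HasACDeriv (Ico 0 l) f fun _ => 0) {x : ℝ}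
    (hx : x ∈ Ico 0 l) : f x = f 0 := by
  have := norm_sub_le_of_ae_norm_deriv_le (F := fun _ => 0) (C := 0) hx.1
    (hf.1 0 ⟨le_rfl, hl⟩ x hx) (by
      filter_upwards [(ae_restrict_iff' measurableSet_Ico).1 hf.2] with t ht hm
      exact ht ⟨hm.1.le, hm.2.trans hx.2⟩) (by simp)
  rw [zero_mul, norm_le_zero_iff, sub_eq_zero] at this
  exact this

end HasACDeriv

/-! ### Matrix Carathéodory derivatives -/

namespace HasACDerivOn

variable {α β γ : Type*} {I : Set ℝ}

theorem const (I : Set ℝ) (C : Matrix α β ℂ) : HasACDerivOn I (fun _ => C) (fun _ => 0) :=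
  hasACDerivOn_iff.2 fun i j => HasACDeriv.const I (C i j)

theorem sub {Y F Z G : ℝ → Matrix α β ℂ} (hY : HasACDerivOn I Y F) (hZ : HasACDerivOn I Z G) :
    HasACDerivOn I (fun x => Y x - Z x) (fun x => F x - G x) :=
  hasACDerivOn_iff.2 fun i j => (hasACDerivOn_iff.1 hY i j).sub (hasACDerivOn_iff.1 hZ i j)

theorem mul [Fintype β] {Y F : ℝ → Matrix α β ℂ} {Z G : ℝ → Matrix β γ ℂ}
    (hY : HasACDerivOn I Y F) (hZ : HasACDerivOn I Z G) :
    HasACDerivOn I (fun x => Y x * Z x) (fun x => F x * Z x + Y x * G x) :=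
  hasACDerivOn_iff.2 fun i j => by
    simp only [Matrix.mul_apply, Matrix.add_apply, ← Finset.sum_add_distrib]
    exact HasACDeriv.sum _ fun k _ =>
      (hasACDerivOn_iff.1 hY i k).mul (hasACDerivOn_iff.1 hZ k j)

theorem conjTranspose {Y F : ℝ → Matrix α β ℂ} (hY : HasACDerivOn I Y F) :
    HasACDerivOn I (fun x => (Y x).conjTranspose) (fun x => (F x).conjTranspose) :=
  hasACDerivOn_iff.2 fun i j => (hasACDerivOn_iff.1 hY j i).star

theorem congr_deriv {Y F G : ℝ → Matrix α β ℂ} (hY : HasACDerivOn I Y F)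
    (h : ∀ x ∈ I, F x = G x) (hI : MeasurableSet I) : HasACDerivOn I Y G :=
  hasACDerivOn_iff.2 fun i j =>
    (hasACDerivOn_iff.1 hY i j).congr_deriv (fun x hx => by rw [h x hx]) hI

theorem mono {J : Set ℝ} {Y F : ℝ → Matrix α β ℂ} (hY : HasACDerivOn I Y F) (h : J ⊆ I) :
    HasACDerivOn J Y F :=
  ⟨fun i j a ha b hb => hY.1 i j a (h ha) b (h hb), fun i j =>
    ae_restrict_of_ae_restrict_of_subset h (hY.2 i j)⟩

theorem const_mul [Fintype α] (C : Matrix γ α ℂ) {Y F : ℝ → Matrix α β ℂ}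
    (hY : HasACDerivOn I Y F) : HasACDerivOn I (fun x => C * Y x) (fun x => C * F x) := by
  simpa using (const I C).mul hY

theorem mul_const [Fintype β] (C : Matrix β γ ℂ) {Y F : ℝ → Matrix α β ℂ}
    (hY : HasACDerivOn I Y F) : HasACDerivOn I (fun x => Y x * C) (fun x => F x * C) := by
  simpa using hY.mul (const I C)

/-- Cramer's rule gives absolute continuity and differentiability of the entries; the value of the
derivative then comes from differentiating `Y Y⁻¹ = 1`. Openness of `I` makes that equation hold in
a neighbourhood of the point. -/
theorem inv [Fintype α] [DecidableEq α] {Y F : ℝ → Matrix α α ℂ} (hI : IsOpen I)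
    (hI' : I.OrdConnected) (hY : HasACDerivOn I Y F) (h0 : ∀ x ∈ I, (Y x).det ≠ 0) :
    HasACDerivOn I (fun x => (Y x)⁻¹) (fun x => -((Y x)⁻¹ * F x * (Y x)⁻¹)) := by
  have hent : ∀ i j, (fun x => (Y x)⁻¹ i j) =
      fun x => ((Y x).det)⁻¹ * ((Y x).updateRow j (Pi.single i 1)).det := by
    intro i j
    ext x
    rw [Matrix.inv_def, Ring.inverse_eq_inv', Matrix.smul_apply, smul_eq_mul,
      Matrix.adjugate_apply]
  refine ⟨fun i j a ha b hb => ?_, fun i j => ?_⟩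
  · simp only [hent]
    refine acOn_mul (acOn_inv (acOn_det fun i j => hY.1 i j a ha b hb) fun x hx =>
      h0 x (hI'.uIcc_subset ha hb hx)) (acOn_det fun p q => ?_)
    simp only [Matrix.updateRow_apply]
    split_ifs
    · exact acOn_const _ a b
    · exact hY.1 p q a ha b hb
  · have hall : ∀ᵐ x ∂(volume.restrict I), ∀ p q, HasDerivAt (fun t => Y t p q) (F x p q) x := by
      have := hY.2
      exact eventually_countable_forall.2 fun p => eventually_countable_forall.2 fun q => this p q
    filter_upwards [hall, ae_restrict_mem hI.measurableSet] with x hx hm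
    have hdiff : ∀ p q, DifferentiableAt ℝ (fun t => (Y t)⁻¹ p q) x := by
      intro p q
      rw [hent]
      refine ((differentiableAt_det fun i j => (hx i j).differentiableAt).inv (h0 x hm)).mul
        (differentiableAt_det fun i j => ?_)
      simp only [Matrix.updateRow_apply]
      split_ifs
      · exact differentiableAt_const _
      · exact (hx i j).differentiableAt
    set D : Matrix α α ℂ := Matrix.of fun p q => deriv (fun t => (Y t)⁻¹ p q) x with hD
    have hDd : ∀ p q, HasDerivAt (fun t => (Y t)⁻¹ p q) (D p q) x := fun p q =>
      (hdiff p q).hasDerivAt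
    have hprod : F x * (Y x)⁻¹ + Y x * D = 0 := by
      ext p q
      have h1 : HasDerivAt (fun t => (Y t * (Y t)⁻¹) p q)
          ((F x * (Y x)⁻¹ + Y x * D) p q) x := by
        simp only [Matrix.mul_apply, Matrix.add_apply, ← Finset.sum_add_distrib]
        exact HasDerivAt.fun_sum fun k _ => (hx p k).mul (hDd k q)
      have h2 : HasDerivAt (fun t => (Y t * (Y t)⁻¹) p q) 0 x := by
        refine (hasDerivAt_const x ((1 : Matrix α α ℂ) p q)).congr_of_eventuallyEq ?_
        filter_upwards [hI.mem_nhds hm] with t ht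
        rw [Matrix.mul_nonsing_inv _ (isUnit_iff_ne_zero.2 (h0 t ht))]
      exact h1.unique h2
    have hDe : D = -((Y x)⁻¹ * F x * (Y x)⁻¹) := by
      have h3 : (Y x)⁻¹ * (F x * (Y x)⁻¹ + Y x * D) = 0 := by rw [hprod, Matrix.mul_zero]
      rw [Matrix.mul_add, ← Matrix.mul_assoc, ← Matrix.mul_assoc,
        Matrix.nonsing_inv_mul _ (isUnit_iff_ne_zero.2 (h0 x hm)), Matrix.one_mul] at h3
      exact eq_neg_of_add_eq_zero_right h3
    rw [← hDe]
    exact hDd i j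

theorem eq_of_deriv_zero {l : ℝ} (hl : 0 < l) {Y : ℝ → Matrix α β ℂ}
    (hY : HasACDerivOn (Ico 0 l) Y fun _ => 0) {x : ℝ} (hx : x ∈ Ico 0 l) : Y x = Y 0 := by
  ext i j
  exact (hasACDerivOn_iff.1 hY i j).eq_of_deriv_zero hl hx

end HasACDerivOn

/-! ### The Darboux matrix -/

theorem brevJ_conjTranspose : brevJ.conjTranspose = -brevJ := by
  ext i j
  fin_cases i <;> fin_cases j <;> simp [brevJ]

theorem brevJ_mul_brevJ : brevJ * brevJ = -1 := by
  ext i j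
  fin_cases i <;> fin_cases j <;> simp [brevJ]

theorem brevJ_mul_brevJ_mul {β : Type*} (M : Matrix (Fin 2) β ℂ) : brevJ * (brevJ * M) = -M := by
  rw [← Matrix.mul_assoc, brevJ_mul_brevJ, Matrix.neg_mul, Matrix.one_mul]

theorem q1_conjTranspose : q1.conjTranspose = brevJ := by
  rw [q1, Matrix.conjTranspose_neg, brevJ_conjTranspose, neg_neg]

/-- A real traceless `2 × 2` matrix times `J̆` is symmetric. This is the only structural property of
`q₀` that the Darboux argument needs. -/
theorem brevJ_mul_diracQ0_conjTranspose (κ : ℤ) (va ve vs : ℝ → ℝ) (x : ℝ) :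
    brevJ * (diracQ0 κ va ve vs x).conjTranspose = -(diracQ0 κ va ve vs x * brevJ) := by
  have h : diracQ0 κ va ve vs x = !![((κ / x + va x : ℝ) : ℂ), ((ve x - vs x : ℝ) : ℂ);
      ((-(ve x + vs x) : ℝ) : ℂ), ((-(κ / x + va x) : ℝ) : ℂ)] := by
    rw [diracQ0, brevJ, pauli3, Matrix.one_fin_two]
    ext i j
    fin_cases i <;> fin_cases j <;> simp
    · ring
  rw [h, brevJ]
  ext i j
  fin_cases i <;> fin_cases j <;>
    simp [Matrix.mul_apply, Fin.sum_univ_two, -Complex.ofReal_neg, -Complex.ofReal_add,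
      -Complex.ofReal_sub]
  all_goals push_cast
  all_goals ring

section

variable {α : Type*} [Fintype α] [DecidableEq α]

omit [DecidableEq α] in
/-- The operator identity `A S - S A* = Π J Π*` is preserved along the flow. -/
theorem operator_identity {l : ℝ} (hl : 0 < l) {A : Matrix α α ℂ}
    {q0 : ℝ → Matrix (Fin 2) (Fin 2) ℂ} {P : ℝ → Matrix α (Fin 2) ℂ} {S : ℝ → Matrix α α ℂ}
    (hq0 : ∀ x, brevJ * (q0 x).conjTranspose = -(q0 x * brevJ))
    (hP : HasACDerivOn (Ico 0 l) P (fun x => A * P x * q1 + P x * q0 x))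
    (hS : HasACDerivOn (Ico 0 l) S (fun x => P x * (P x).conjTranspose))
    (h0 : A * S 0 - S 0 * A.conjTranspose = P 0 * brevJ * (P 0).conjTranspose)
    {x : ℝ} (hx : x ∈ Ico 0 l) :
    A * S x - S x * A.conjTranspose = P x * brevJ * (P x).conjTranspose := by
  have h := (((hS.const_mul A).sub (hS.mul_const A.conjTranspose)).sub
    ((hP.mul_const brevJ).mul hP.conjTranspose)).congr_deriv (G := fun _ => 0) (fun t _ => by
      -- In the derivative of `A S - S A* - Π J̆ Π*`, the `q₀` terms cancel by `hq0`, and the `A`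
      -- terms cancel because `q₁ J̆ = 1`.
      have h1 : P t * brevJ * ((q0 t).conjTranspose * (P t).conjTranspose) =
          -(P t * q0 t * brevJ * (P t).conjTranspose) := by
        rw [Matrix.mul_assoc (P t), ← Matrix.mul_assoc brevJ, hq0]
        simp only [Matrix.neg_mul, Matrix.mul_neg, Matrix.mul_assoc]
      have h2 : A * P t * q1 * brevJ = A * P t := by
        rw [Matrix.mul_assoc, q1, Matrix.neg_mul, brevJ_mul_brevJ, neg_neg, Matrix.mul_one]
      have h3 : P t * brevJ * (brevJ * ((P t).conjTranspose * A.conjTranspose)) =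
          -(P t * (P t).conjTranspose * A.conjTranspose) := by
        rw [Matrix.mul_assoc, brevJ_mul_brevJ_mul, Matrix.mul_neg, Matrix.mul_assoc]
      rw [Matrix.conjTranspose_add, Matrix.conjTranspose_mul, Matrix.conjTranspose_mul,
        Matrix.conjTranspose_mul, q1_conjTranspose, Matrix.mul_add, h1, h3, Matrix.add_mul, h2,
        Matrix.add_mul, ← Matrix.mul_assoc A]
      abel) measurableSet_Ico
  have := h.eq_of_deriv_zero hl hx
  rw [h0, sub_self, sub_eq_zero] at this
  exact this

/-- The left side is the product rule applied to `w_A`, in the shape in which it arises. With `K =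
Π* S⁻¹`, the operator identity gives `(J̆ K)' = -K A - q̃₀ J̆ K`. `W` and `qt` are variables, so
that they stay opaque until their formulas are needed. -/
theorem darboux_deriv_identity {A S Rl : Matrix α α ℂ} {P : Matrix α (Fin 2) ℂ}
    {q0 : Matrix (Fin 2) (Fin 2) ℂ} {lam : ℂ} (hq0 : brevJ * q0.conjTranspose = -(q0 * brevJ))
    (hS : IsUnit S.det) (hid : A * S - S * A.conjTranspose = P * brevJ * P.conjTranspose)
    (h1 : Rl * (A - lam • (1 : Matrix α α ℂ)) = 1) (h2 : (A - lam • (1 : Matrix α α ℂ)) * Rl = 1)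
    (W qt : Matrix (Fin 2) (Fin 2) ℂ)
    (hW : W = 1 - brevJ * P.conjTranspose * S⁻¹ * Rl * P)
    (hqt : qt = q0 + brevJ * (P.conjTranspose * S⁻¹ * P) * brevJ.conjTranspose
      - P.conjTranspose * S⁻¹ * P) :
    0 - ((brevJ * (A * P * q1 + P * q0).conjTranspose * S⁻¹
        + brevJ * P.conjTranspose * -(S⁻¹ * (P * P.conjTranspose) * S⁻¹)) * Rl * P
        + brevJ * P.conjTranspose * S⁻¹ * Rl * (A * P * q1 + P * q0)) =
      -((lam • q1 + qt) * W) + W * (lam • q1 + q0) := by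
  have hAS : A.conjTranspose * S⁻¹ = S⁻¹ * A - S⁻¹ * (P * brevJ * P.conjTranspose) * S⁻¹ := by
    rw [← hid, Matrix.mul_sub, Matrix.sub_mul]
    have e1 : S⁻¹ * (A * S) * S⁻¹ = S⁻¹ * A := by
      rw [Matrix.mul_assoc, Matrix.mul_assoc A, Matrix.mul_nonsing_inv _ hS, Matrix.mul_one]
    have e2 : S⁻¹ * (S * A.conjTranspose) * S⁻¹ = A.conjTranspose * S⁻¹ := by
      rw [← Matrix.mul_assoc, Matrix.nonsing_inv_mul _ hS, Matrix.one_mul]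
    rw [e1, e2]
    abel
  have hAR : A * Rl = 1 + lam • Rl := by
    rw [Matrix.sub_mul, Matrix.smul_mul, Matrix.one_mul] at h2
    exact eq_add_of_sub_eq h2
  have hRA : Rl * A = 1 + lam • Rl := by
    rw [Matrix.mul_sub, Matrix.mul_smul, Matrix.mul_one] at h1
    exact eq_add_of_sub_eq h1
  obtain ⟨K, hK⟩ : ∃ K, K = P.conjTranspose * S⁻¹ := ⟨_, rfl⟩
  have hY : brevJ * (A * P * q1 + P * q0).conjTranspose * S⁻¹
        + brevJ * P.conjTranspose * -(S⁻¹ * (P * P.conjTranspose) * S⁻¹) =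
      -(K * A) - qt * (brevJ * K) := by
    have e1 : brevJ * (q0.conjTranspose * K) = -(q0 * (brevJ * K)) := by
      rw [← Matrix.mul_assoc, hq0, Matrix.neg_mul, Matrix.mul_assoc]
    have e2 : P.conjTranspose * (A.conjTranspose * S⁻¹) = K * A - K * (P * (brevJ * K)) := by
      rw [hAS, hK]
      simp only [Matrix.mul_sub, Matrix.mul_assoc]
    rw [Matrix.conjTranspose_add, Matrix.conjTranspose_mul, Matrix.conjTranspose_mul,
      Matrix.conjTranspose_mul, q1_conjTranspose, hqt, brevJ_conjTranspose]
    simp only [Matrix.mul_assoc, Matrix.add_mul, Matrix.mul_add, Matrix.sub_mul, Matrix.neg_mul,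
      Matrix.mul_neg, brevJ_mul_brevJ_mul, neg_neg]
    rw [e2, ← hK, e1]
    have e3 : P.conjTranspose * (S⁻¹ * (P * K)) = K * (P * K) := by
      rw [hK]; simp only [Matrix.mul_assoc]
    have e4 : P.conjTranspose * (S⁻¹ * (P * (brevJ * K))) = K * (P * (brevJ * K)) := by
      rw [hK]; simp only [Matrix.mul_assoc]
    rw [e3, e4]
    abel
  have hW' : W = 1 - brevJ * (K * (Rl * P)) := by
    rw [hW, hK]; simp only [Matrix.mul_assoc]
  have hqt' : qt = q0 - brevJ * (K * (P * brevJ)) - K * P := by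
    rw [hqt, hK, brevJ_conjTranspose]
    simp only [Matrix.mul_assoc, Matrix.mul_neg]
    abel
  have hlast : brevJ * P.conjTranspose * S⁻¹ = brevJ * K := by rw [hK, Matrix.mul_assoc]
  -- Trading `A` next to its resolvent for `λ` leaves the free terms `K Π` and `J̆ K Π J̆`, exactly
  -- those that separate `q̃₀` from `q₀`.
  have f1 : K * (A * (Rl * P)) = K * P + lam • (K * (Rl * P)) := by
    rw [← Matrix.mul_assoc A, hAR]
    simp only [Matrix.add_mul, Matrix.mul_add, Matrix.one_mul, Matrix.smul_mul, Matrix.mul_smul]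
  have f2 : Rl * (A * (P * brevJ)) = P * brevJ + lam • (Rl * (P * brevJ)) := by
    rw [← Matrix.mul_assoc Rl, hRA]
    simp only [Matrix.add_mul, Matrix.one_mul, Matrix.smul_mul]
  rw [hY, hlast, hW']
  simp only [Matrix.sub_mul, Matrix.mul_sub, Matrix.add_mul, Matrix.mul_add, Matrix.neg_mul,
    Matrix.mul_neg, Matrix.mul_assoc, q1, Matrix.smul_mul, Matrix.mul_smul, Matrix.mul_one,
    Matrix.one_mul, brevJ_mul_brevJ_mul, smul_neg, f1, f2]
  rw [hqt']
  simp only [Matrix.sub_mul, Matrix.mul_assoc, smul_sub]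
  abel

theorem isUnit_sub_smul {A : Matrix α α ℂ} {lam : ℂ} (h : lam ∉ spectrum ℂ A) :
    IsUnit (A - lam • (1 : Matrix α α ℂ)).det := by
  rw [spectrum.notMem_iff, Algebra.algebraMap_eq_smul_one] at h
  rw [← Matrix.isUnit_iff_isUnit_det, ← neg_sub]
  exact h.neg

/-- Sylvester's identity moves the determinant to the large space, where the operator identity
factors the matrix as `(A - λ)⁻¹ S (A* - λ) S⁻¹`. -/
theorem transferW_det_ne_zero {A : Matrix α α ℂ} {S : ℝ → Matrix α α ℂ}
    {P : ℝ → Matrix α (Fin 2) ℂ} {lam : ℂ} {x : ℝ} (hS : IsUnit (S x).det)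
    (hid : A * S x - S x * A.conjTranspose = P x * brevJ * (P x).conjTranspose)
    (h1 : lam ∉ spectrum ℂ A) (h2 : lam ∉ spectrum ℂ A.conjTranspose) :
    (transferW A P S lam x).det ≠ 0 := by
  have u1 := isUnit_sub_smul h1
  have u2 := isUnit_sub_smul h2
  set Rl := (A - lam • (1 : Matrix α α ℂ))⁻¹ with hRl
  have hRA : Rl * (A - lam • (1 : Matrix α α ℂ)) = 1 := Matrix.nonsing_inv_mul _ u1
  have e : transferW A P S lam x =
      1 - (brevJ * (P x).conjTranspose * (S x)⁻¹) * (Rl * P x) := by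
    simp only [transferW, Matrix.mul_assoc, hRl]
  have e2 : 1 - Rl * P x * (brevJ * (P x).conjTranspose * (S x)⁻¹) =
      Rl * (S x * (A.conjTranspose - lam • (1 : Matrix α α ℂ)) * (S x)⁻¹) := by
    have : Rl * P x * (brevJ * (P x).conjTranspose * (S x)⁻¹) =
        Rl * ((P x * brevJ * (P x).conjTranspose) * (S x)⁻¹) := by
      simp only [Matrix.mul_assoc]
    have hM : ∀ M : Matrix α α ℂ, 1 - Rl * M = Rl * (A - lam • (1 : Matrix α α ℂ) - M) :=
      fun M => by rw [Matrix.mul_sub, hRA]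
    rw [this, ← hid, hM]
    congr 1
    simp only [Matrix.sub_mul, Matrix.mul_sub, Matrix.mul_assoc, Matrix.smul_mul,
      Matrix.mul_smul, Matrix.mul_nonsing_inv _ hS, Matrix.mul_one]
    abel
  rw [e, Matrix.det_one_sub_mul_comm, e2, Matrix.det_mul, Matrix.det_mul, Matrix.det_mul]
  have u3 : IsUnit Rl.det := by
    rw [hRl]; exact (Matrix.isUnit_nonsing_inv_det_iff).2 u1
  have u4 : IsUnit ((S x)⁻¹).det := (Matrix.isUnit_nonsing_inv_det_iff).2 hS
  exact (u3.mul ((hS.mul u2).mul u4)).ne_zero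

theorem isFundamentalSolution_transferW {l : ℝ} {A : Matrix α α ℂ}
    {q0 : ℝ → Matrix (Fin 2) (Fin 2) ℂ} {P : ℝ → Matrix α (Fin 2) ℂ} {S : ℝ → Matrix α α ℂ}
    (hq0 : ∀ x, brevJ * (q0 x).conjTranspose = -(q0 x * brevJ))
    (hP : HasACDerivOn (Ioo 0 l) P (fun x => A * P x * q1 + P x * q0 x))
    (hS : HasACDerivOn (Ioo 0 l) S (fun x => P x * (P x).conjTranspose))
    (hdet : ∀ x ∈ Ioo 0 l, (S x).det ≠ 0)
    (hid : ∀ x ∈ Ioo 0 l,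
      A * S x - S x * A.conjTranspose = P x * brevJ * (P x).conjTranspose)
    {lam : ℂ} (h1 : lam ∉ spectrum ℂ A) (h2 : lam ∉ spectrum ℂ A.conjTranspose)
    {u : ℝ → Matrix (Fin 2) (Fin 2) ℂ} (hu : IsFundamentalSolution l q0 lam u) :
    IsFundamentalSolution l (transformedQ0 q0 P S) lam
      (fun x => transferW A P S lam x * u x) := by
  refine ⟨?_, fun x hx => ?_⟩
  · have hSi := hS.inv isOpen_Ioo ordConnected_Ioo hdet
    have hw := (HasACDerivOn.const (Ioo 0 l) (1 : Matrix (Fin 2) (Fin 2) ℂ)).sub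
      ((((hP.conjTranspose.const_mul brevJ).mul hSi).mul_const
        (A - lam • (1 : Matrix α α ℂ))⁻¹).mul hP)
    refine (hw.mul hu.1).congr_deriv (fun x hx => ?_) measurableSet_Ioo
    have u1 := isUnit_sub_smul h1
    have key := darboux_deriv_identity (hq0 x) (isUnit_iff_ne_zero.2 (hdet x hx)) (hid x hx)
      (Matrix.nonsing_inv_mul _ u1) (Matrix.mul_nonsing_inv _ u1) (transferW A P S lam x)
      (transformedQ0 q0 P S x) rfl rfl
    rw [key]
    change _ + transferW A P S lam x * _ = _
    simp only [Matrix.add_mul, Matrix.neg_mul, Matrix.mul_neg, Matrix.mul_add, Matrix.mul_assoc]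
    abel
  · rw [Matrix.det_mul]
    exact mul_ne_zero (transferW_det_ne_zero (isUnit_iff_ne_zero.2 (hdet x hx)) (hid x hx) h1 h2)
      (hu.2 x hx)

end

/-- The off-diagonal blocks are the reason for the choice of `R`: `R S₁ = Ψ₂ J̆ Ψ₁*`. -/
theorem operator_identity_init {m n : Type*} [Fintype m] [Fintype n] [DecidableEq m]
    {A₁ S₁ : Matrix m m ℂ} {A₂ : Matrix n n ℂ} {Ψ₁ : Matrix m (Fin 2) ℂ}
    {Ψ₂ : Matrix n (Fin 2) ℂ} (hS : IsUnit S₁.det) (hH : S₁.conjTranspose = S₁)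
    (hΨ₁ : A₁ * S₁ - S₁ * A₁.conjTranspose = Ψ₁ * brevJ * Ψ₁.conjTranspose)
    (hΨ₂ : Ψ₂ * brevJ * Ψ₂.conjTranspose = 0) :
    Matrix.fromBlocks A₁ 0 (Ψ₂ * brevJ * Ψ₁.conjTranspose * S₁⁻¹) A₂ *
        Matrix.fromBlocks S₁ 0 0 0 - Matrix.fromBlocks S₁ 0 0 0 *
        (Matrix.fromBlocks A₁ 0 (Ψ₂ * brevJ * Ψ₁.conjTranspose * S₁⁻¹) A₂).conjTranspose =
      Matrix.fromRows Ψ₁ Ψ₂ * brevJ * (Matrix.fromRows Ψ₁ Ψ₂).conjTranspose := by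
  have hR : Ψ₂ * brevJ * Ψ₁.conjTranspose * S₁⁻¹ * S₁ = Ψ₂ * brevJ * Ψ₁.conjTranspose := by
    rw [Matrix.mul_assoc, Matrix.nonsing_inv_mul _ hS, Matrix.mul_one]
  have hR' : S₁ * (Ψ₂ * brevJ * Ψ₁.conjTranspose * S₁⁻¹).conjTranspose =
      -(Ψ₁ * brevJ * Ψ₂.conjTranspose) := by
    have := congrArg Matrix.conjTranspose hR
    rw [Matrix.conjTranspose_mul, hH] at this
    rw [this]
    simp only [Matrix.conjTranspose_mul, Matrix.conjTranspose_conjTranspose, brevJ_conjTranspose,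
      Matrix.neg_mul, Matrix.mul_neg, Matrix.mul_assoc]
  rw [Matrix.fromBlocks_conjTranspose, Matrix.fromBlocks_multiply, Matrix.fromBlocks_multiply,
    Matrix.conjTranspose_fromRows_eq_fromCols_conjTranspose, Matrix.fromRows_mul,
    Matrix.fromRows_mul_fromCols, hΨ₂, ← hΨ₁]
  simp only [Matrix.mul_zero, Matrix.zero_mul, add_zero, Matrix.conjTranspose_zero, hR, hR',
    sub_eq_add_neg, Matrix.fromBlocks_neg, Matrix.fromBlocks_add, neg_zero, zero_add, neg_neg]

/-! ### The Gram matrix of the leading terms -/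

theorem pauli3_mul_pauli3 : pauli3 * pauli3 = 1 := by
  ext i j
  fin_cases i <;> fin_cases j <;> simp [pauli3]

theorem pauli3_conjTranspose : pauli3.conjTranspose = pauli3 := by
  ext i j
  fin_cases i <;> fin_cases j <;> simp [pauli3]

theorem q1_mul_pauli3 : q1 * pauli3 = -(pauli3 * q1) := by
  ext i j
  fin_cases i <;> fin_cases j <;> simp [pauli3, q1, brevJ]

/-- The Taylor coefficients `h q₁ ^ k / k!` of `x ↦ h exp (x q₁)`. -/
noncomputable def leadingRow (h : Fin 2 → ℂ) : ℕ → Fin 2 → ℂ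
  | 0 => h
  | k + 1 => ((k : ℂ) + 1)⁻¹ • Matrix.vecMul (leadingRow h k) q1

/-- The first `n` Taylor coefficients `h q₁ ^ k / k!`, as rows of a matrix. -/
noncomputable def leadingMatrix (n : ℕ) (h : Fin 2 → ℂ) : Matrix (Fin n) (Fin 2) ℂ :=
  Matrix.of fun k => leadingRow h k

theorem leadingRow_ne_zero {h : Fin 2 → ℂ} (hh : h ≠ 0) (k : ℕ) : leadingRow h k ≠ 0 := by
  induction k with
  | zero => exact hh
  | succ k ih =>
    intro h0
    have hk : ((k : ℂ) + 1)⁻¹ ≠ 0 := inv_ne_zero (by exact_mod_cast Nat.succ_ne_zero k)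
    have h1 : Matrix.vecMul (leadingRow h k) q1 = 0 := (smul_eq_zero.1 h0).resolve_left hk
    apply ih
    have h2 : Matrix.vecMul (Matrix.vecMul (leadingRow h k) q1) brevJ = leadingRow h k := by
      rw [Matrix.vecMul_vecMul, q1, Matrix.neg_mul, brevJ_mul_brevJ, neg_neg, Matrix.vecMul_one]
    rw [← h2, h1, Matrix.zero_vecMul]

/-- `q₁` anticommutes with `σ₃`, so each further factor flips the eigenvalue. -/
theorem leadingRow_vecMul_pauli3 {h : Fin 2 → ℂ} {s : ℂ} (hs : Matrix.vecMul h pauli3 = s • h)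
    (k : ℕ) : Matrix.vecMul (leadingRow h k) pauli3 = (s * (-1) ^ k) • leadingRow h k := by
  induction k with
  | zero => simpa [leadingRow] using hs
  | succ k ih =>
    rw [leadingRow, Matrix.smul_vecMul, Matrix.vecMul_vecMul, q1_mul_pauli3, Matrix.vecMul_neg,
      ← Matrix.vecMul_vecMul, ih, Matrix.smul_vecMul, ← neg_smul, smul_comm, pow_succ]
    congr 1
    ring

/-- The Cauchy-type Gram matrix `(V V*)_{jk} / (j + k + 1)`. -/
noncomputable def cauchyGram {n : ℕ} (V : Matrix (Fin n) (Fin 2) ℂ) : Matrix (Fin n) (Fin n) ℂ :=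
  Matrix.of fun j k => (V * V.conjTranspose) j k / ((j : ℕ) + (k : ℕ) + 1)

theorem sum_range_alternating_odd (n : ℕ) :
    ∑ k ∈ Finset.range n, (-1 : ℂ) ^ k * (2 * k + 1) = -((-1) ^ n * n) := by
  induction n with
  | zero => simp
  | succ n ih =>
    rw [Finset.sum_range_succ, ih, pow_succ]
    push_cast
    ring

section

variable {n : ℕ} {V : Matrix (Fin n) (Fin 2) ℂ}

theorem cauchyGram_lyapunov :
    Matrix.diagonal (fun k : Fin n => (2 * (k : ℕ) + 1 : ℂ)) * cauchyGram V +
      cauchyGram V * Matrix.diagonal (fun k : Fin n => (2 * (k : ℕ) + 1 : ℂ)) =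
    (2 : ℂ) • (V * V.conjTranspose) := by
  ext j k
  have : (((j : ℕ) : ℂ) + (k : ℕ) + 1) ≠ 0 := by
    exact_mod_cast Nat.succ_ne_zero ((j : ℕ) + k)
  rw [Matrix.add_apply, Matrix.diagonal_mul, Matrix.mul_diagonal, cauchyGram, Matrix.of_apply,
    Matrix.smul_apply, smul_eq_mul]
  field_simp
  ring

theorem cauchyGram_conjTranspose : (cauchyGram V).conjTranspose = cauchyGram V := by
  ext j k
  have h : (V * V.conjTranspose).conjTranspose = V * V.conjTranspose := by simp
  have h1 := congrFun (congrFun h j) k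
  rw [Matrix.conjTranspose_apply] at h1
  rw [Matrix.conjTranspose_apply, cauchyGram, Matrix.of_apply, Matrix.of_apply, star_div₀, h1]
  simp [add_comm]

/-- If `H y = 0`, pairing the Lyapunov equation `N H + H N = 2 V V*` with `y` gives `2 ‖V* y‖² = 0`;
the equation applied to `y` then leaves `H N y = 0`. So the kernel of `H` lies in that of `V*` and
is invariant under `N`. -/
theorem cauchyGram_mulVec_eq_zero {y : Fin n → ℂ} (hy : (cauchyGram V).mulVec y = 0) :
    V.conjTranspose.mulVec y = 0 ∧
      (cauchyGram V).mulVec (fun k => (2 * (k : ℕ) + 1 : ℂ) * y k) = 0 := by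
  have hN : (fun k : Fin n => (2 * (k : ℕ) + 1 : ℂ) * y k) =
      (Matrix.diagonal (fun k : Fin n => (2 * (k : ℕ) + 1 : ℂ))).mulVec y := by
    ext k
    rw [Matrix.mulVec_diagonal]
  have h1 := congrArg (fun M => Matrix.mulVec M y) (cauchyGram_lyapunov (V := V))
  simp only [Matrix.add_mulVec, ← Matrix.mulVec_mulVec, hy, Matrix.mulVec_zero, zero_add,
    Matrix.smul_mulVec] at h1
  have hystar : Matrix.vecMul (star y) (cauchyGram V) = 0 := by
    have := congrArg star hy
    rw [Matrix.star_mulVec, cauchyGram_conjTranspose, star_zero] at this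
    exact this
  have h2 : V.conjTranspose.mulVec y = 0 := by
    have h3 : dotProduct (star y) ((2 : ℂ) • V.mulVec (V.conjTranspose.mulVec y)) = 0 := by
      rw [← h1, Matrix.dotProduct_mulVec, hystar, zero_dotProduct]
    have h4 : dotProduct (Matrix.vecMul (star y) V) (V.conjTranspose.mulVec y) = 0 := by
      rw [← Matrix.dotProduct_mulVec]
      rw [dotProduct_smul] at h3
      exact (smul_eq_zero.1 h3).resolve_left two_ne_zero
    have h6 : Matrix.vecMul (star y) V = star (V.conjTranspose.mulVec y) := by
      rw [Matrix.star_mulVec, Matrix.conjTranspose_conjTranspose]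
    rw [h6] at h4
    exact dotProduct_star_self_eq_zero.1 h4
  refine ⟨h2, ?_⟩
  rw [hN, h1, h2, Matrix.mulVec_zero, smul_zero]

theorem cauchyGram_det_ne_zero (hV : ∀ k, V k ≠ 0) : (cauchyGram V).det ≠ 0 := by
  intro hdet
  obtain ⟨y, hy0, hy⟩ := Matrix.exists_mulVec_eq_zero_iff.2 hdet
  obtain ⟨k, hk⟩ : ∃ k, y k ≠ 0 := Function.ne_iff.1 hy0
  -- `N` has distinct eigenvalues, so Lagrange products in `N` isolate a single coordinate of a
  -- kernel vector. The kernel would then contain a multiple of a basis vector, on which `V*`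
  -- vanishes only if a row of `V` does.
  have hprod : ∀ s : Finset (Fin n), (cauchyGram V).mulVec
      (fun i => (∏ j ∈ s, (((i : ℕ) : ℂ) - (j : ℕ))) * y i) = 0 := by
    intro s
    induction s using Finset.induction_on with
    | empty => simpa using hy
    | insert a s ha ih =>
      have h1 := (cauchyGram_mulVec_eq_zero ih).2
      have e : (fun i : Fin n => (∏ j ∈ insert a s, (((i : ℕ) : ℂ) - (j : ℕ))) * y i) =
          (2 : ℂ)⁻¹ • (fun i : Fin n => (2 * (i : ℕ) + 1 : ℂ) *
            ((∏ j ∈ s, (((i : ℕ) : ℂ) - (j : ℕ))) * y i)) -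
          ((a : ℕ) + (2 : ℂ)⁻¹) • (fun i : Fin n => (∏ j ∈ s, (((i : ℕ) : ℂ) - (j : ℕ))) * y i) := by
        ext i
        rw [Finset.prod_insert ha]
        simp only [Pi.sub_apply, Pi.smul_apply, smul_eq_mul]
        ring
      rw [e, Matrix.mulVec_sub, Matrix.mulVec_smul, Matrix.mulVec_smul, h1, ih, smul_zero,
        smul_zero, sub_zero]
  have h1 := (cauchyGram_mulVec_eq_zero (hprod (Finset.univ.erase k))).1
  apply hV k
  ext b
  have h2 := congrFun h1 b
  rw [Matrix.mulVec, dotProduct, Finset.sum_eq_single k] at h2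
  · have h3 : ∏ j ∈ Finset.univ.erase k, (((k : ℕ) : ℂ) - (j : ℕ)) ≠ 0 := by
      refine Finset.prod_ne_zero_iff.2 fun j hj => sub_ne_zero.2 fun h => ?_
      exact Finset.ne_of_mem_erase hj (Fin.ext (by exact_mod_cast h.symm))
    have h4 := (mul_eq_zero.1 h2).resolve_right (mul_ne_zero h3 hk)
    rw [Matrix.conjTranspose_apply] at h4
    exact star_eq_zero.1 h4
  · intro i _ hi
    rw [Finset.prod_eq_zero (Finset.mem_erase.2 ⟨hi, Finset.mem_univ i⟩) (sub_self _), zero_mul,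
      mul_zero]
  · simp

/-- With `Sg = diag((-1) ^ k)`, the hypothesis reads `V σ₃ = s Sg V`. Hence `Sg` commutes with `H`,
and `M = V* H⁻¹ V` commutes with `σ₃`, so `M` is diagonal. Conjugation by `J̆` swaps its two
entries, and only `tr(σ₃ M)` remains to be computed. -/
theorem brevJ_conj_sub_of_gram {s : ℂ} (hs : s = 1 ∨ s = -1) (hV : ∀ k, V k ≠ 0)
    (hVs : ∀ k : Fin n, Matrix.vecMul (V k) pauli3 = (s * (-1) ^ (k : ℕ)) • V k) :
    brevJ * (V.conjTranspose * (cauchyGram V)⁻¹ * V) * brevJ.conjTranspose -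
      V.conjTranspose * (cauchyGram V)⁻¹ * V = (s * (-1) ^ n * n) • pauli3 := by
  set H := cauchyGram V with hH
  set Sg : Matrix (Fin n) (Fin n) ℂ := Matrix.diagonal fun k => (-1) ^ (k : ℕ) with hSg
  set N : Matrix (Fin n) (Fin n) ℂ := Matrix.diagonal fun k => (2 * (k : ℕ) + 1 : ℂ) with hN
  have hss : s * s = 1 := by rcases hs with rfl | rfl <;> norm_num
  have hstar : star s = s := by rcases hs with rfl | rfl <;> simp
  have hdet : IsUnit H.det := isUnit_iff_ne_zero.2 (cauchyGram_det_ne_zero hV)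
  have hVp : V * pauli3 = s • (Sg * V) := by
    ext k b
    have := congrFun (hVs k) b
    rw [Matrix.smul_apply, hSg, Matrix.diagonal_mul, smul_eq_mul, ← mul_assoc]
    exact this
  have hSgV : Sg * V = s • (V * pauli3) := by rw [hVp, smul_smul, hss, one_smul]
  have hSgstar : Sg.conjTranspose = Sg := by
    rw [hSg, Matrix.diagonal_conjTranspose]
    congr 1
    ext k
    simp
  have hSgSg : Sg * Sg = 1 := by
    rw [hSg, Matrix.diagonal_mul_diagonal, ← Matrix.diagonal_one]
    congr 1
    ext k
    rw [← mul_pow]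
    norm_num
  have hG : Sg * (V * V.conjTranspose) * Sg = V * V.conjTranspose := by
    have : Sg * (V * V.conjTranspose) * Sg = (Sg * V) * (Sg * V).conjTranspose := by
      rw [Matrix.conjTranspose_mul, hSgstar]
      simp only [Matrix.mul_assoc]
    rw [this, hSgV, Matrix.conjTranspose_smul, hstar, Matrix.smul_mul, Matrix.mul_smul, smul_smul,
      hss, one_smul, Matrix.conjTranspose_mul, pauli3_conjTranspose, Matrix.mul_assoc,
      ← Matrix.mul_assoc pauli3, pauli3_mul_pauli3, Matrix.one_mul]
  have hSHS : Sg * H * Sg = H := by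
    ext j k
    have := congrFun (congrFun hG j) k
    rw [hSg, Matrix.mul_diagonal, Matrix.diagonal_mul] at this ⊢
    rw [hH, cauchyGram, Matrix.of_apply]
    conv_rhs => rw [← this]
    ring
  have hcomm : Sg * H = H * Sg := by
    conv_rhs => rw [← hSHS]
    rw [Matrix.mul_assoc, hSgSg, Matrix.mul_one]
  have hSHiS : Sg * H⁻¹ * Sg = H⁻¹ := by
    have h1 : (Sg * H⁻¹ * Sg) * H = 1 := by
      rw [Matrix.mul_assoc, hcomm, ← Matrix.mul_assoc, Matrix.mul_assoc Sg,
        Matrix.nonsing_inv_mul _ hdet, Matrix.mul_one, hSgSg]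
    exact (Matrix.inv_eq_left_inv h1).symm
  set M := V.conjTranspose * H⁻¹ * V with hM
  have hpV : pauli3 * V.conjTranspose = s • (V.conjTranspose * Sg) := by
    have := congrArg Matrix.conjTranspose hVp
    rw [Matrix.conjTranspose_mul, pauli3_conjTranspose, Matrix.conjTranspose_smul, hstar,
      Matrix.conjTranspose_mul, hSgstar] at this
    exact this
  have hpMp : pauli3 * M * pauli3 = M := by
    have : pauli3 * M * pauli3 = (pauli3 * V.conjTranspose) * H⁻¹ * (V * pauli3) := by
      rw [hM]; simp only [Matrix.mul_assoc]
    rw [this, hpV, hVp, Matrix.smul_mul, Matrix.smul_mul, Matrix.mul_smul, smul_smul, hss,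
      one_smul, hM]
    have h2 : V.conjTranspose * Sg * H⁻¹ * (Sg * V) = V.conjTranspose * (Sg * H⁻¹ * Sg) * V := by
      simp only [Matrix.mul_assoc]
    rw [h2, hSHiS]
  -- Replacing `V V*` by `(N H + H N) / 2` cancels `H⁻¹` in both summands and leaves `s tr(Sg N)`,
  -- an alternating sum of odd numbers.
  have htr : (pauli3 * M).trace = -(s * (-1) ^ n * n) := by
    have h1 : (pauli3 * M).trace = (H⁻¹ * (V * pauli3 * V.conjTranspose)).trace := by
      have : pauli3 * M = (pauli3 * V.conjTranspose) * (H⁻¹ * V) := by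
        rw [hM]; simp only [Matrix.mul_assoc]
      rw [this, Matrix.trace_mul_comm, Matrix.mul_assoc, ← Matrix.mul_assoc V]
    have h2 : V * V.conjTranspose = (2 : ℂ)⁻¹ • (N * H + H * N) := by
      rw [cauchyGram_lyapunov, smul_smul, inv_mul_cancel₀ two_ne_zero, one_smul]
    have h3 : (H⁻¹ * (Sg * (N * H))).trace = (Sg * N).trace := by
      rw [Matrix.trace_mul_comm, Matrix.mul_assoc, Matrix.mul_assoc, Matrix.mul_nonsing_inv _ hdet,
        Matrix.mul_one]
    have h4 : H⁻¹ * (Sg * (H * N)) = Sg * N := by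
      rw [← Matrix.mul_assoc Sg, hcomm, Matrix.mul_assoc, ← Matrix.mul_assoc,
        Matrix.nonsing_inv_mul _ hdet, Matrix.one_mul]
    have h5 : (Sg * N).trace = -((-1) ^ n * n) := by
      rw [hSg, hN, Matrix.diagonal_mul_diagonal, Matrix.trace_diagonal, ← sum_range_alternating_odd,
        ← Fin.sum_univ_eq_sum_range (fun k => (-1 : ℂ) ^ k * (2 * k + 1))]
    rw [h1, hVp, Matrix.smul_mul, Matrix.mul_assoc, h2, Matrix.mul_smul, Matrix.mul_smul,
      Matrix.mul_smul, Matrix.trace_smul, Matrix.trace_smul, Matrix.mul_add, Matrix.mul_add,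
      Matrix.trace_add, h3, h4, h5, smul_eq_mul, smul_eq_mul]
    ring
  have m01 : M 0 1 = 0 := by
    have := congrFun (congrFun hpMp 0) 1
    simp only [pauli3, Matrix.mul_apply, Fin.sum_univ_two] at this
    simp at this
    linear_combination (-1 / 2 : ℂ) * this
  have m10 : M 1 0 = 0 := by
    have := congrFun (congrFun hpMp 1) 0
    simp only [pauli3, Matrix.mul_apply, Fin.sum_univ_two] at this
    simp at this
    linear_combination (-1 / 2 : ℂ) * this
  have mtr : M 0 0 - M 1 1 = -(s * (-1) ^ n * n) := by
    rw [← htr]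
    simp only [Matrix.trace, Matrix.diag, pauli3, Matrix.mul_apply, Fin.sum_univ_two]
    simp
    ring
  clear_value M
  rw [brevJ_conjTranspose, Matrix.eta_fin_two M, m01, m10]
  ext i j
  fin_cases i <;> fin_cases j <;> simp [brevJ, pauli3]
  · linear_combination -mtr
  · linear_combination mtr

end

/-! ### Controllability of the singular block -/

/-- The Krylov matrix with columns `A ^ k ψ`. -/
noncomputable def krylov {n : ℕ} (A : Matrix (Fin n) (Fin n) ℂ) (ψ : Fin n → ℂ) :
    Matrix (Fin n) (Fin n) ℂ :=
  Matrix.of fun i k => (A ^ (k : ℕ)).mulVec ψ i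

/-- This is the Hautus test. By Cayley–Hamilton, a row vector orthogonal to the first `n` vectors `A
^ k ψ` is orthogonal to all of them. Such row vectors form a nonzero invariant subspace, which
contains an eigenvector over `ℂ`. -/
theorem exists_left_eigenvector_of_krylov_det_eq_zero {n : ℕ} {A : Matrix (Fin n) (Fin n) ℂ}
    {ψ : Fin n → ℂ} (h : (krylov A ψ).det = 0) :
    ∃ y : Fin n → ℂ, y ≠ 0 ∧ (∃ μ : ℂ, Matrix.vecMul y A = μ • y) ∧ dotProduct y ψ = 0 := by
  obtain ⟨z, hz0, hz⟩ := Matrix.exists_vecMul_eq_zero_iff.2 h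
  have hz1 : ∀ k < n, dotProduct z ((A ^ k).mulVec ψ) = 0 := fun k hk => congrFun hz ⟨k, hk⟩
  have hz2 : ∀ k, dotProduct z ((A ^ k).mulVec ψ) = 0 := by
    intro k
    rw [Matrix.pow_eq_aeval_mod_charpoly, Polynomial.aeval_eq_sum_range, Matrix.sum_mulVec,
      dotProduct_sum]
    refine Finset.sum_eq_zero fun i hi => ?_
    rw [Matrix.smul_mulVec, dotProduct_smul]
    by_cases hin : i < n
    · rw [hz1 i hin, smul_zero]
    · rw [Polynomial.coeff_eq_zero_of_degree_lt, zero_smul]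
      refine (Polynomial.degree_modByMonic_lt _ A.charpoly_monic).trans_le ?_
      rw [Matrix.charpoly_degree_eq_dim, Fintype.card_fin]
      exact_mod_cast not_lt.1 hin
  let W : Submodule ℂ (Fin n → ℂ) :=
    { carrier := {y | ∀ k, dotProduct y ((A ^ k).mulVec ψ) = 0}
      add_mem' := fun {a b} ha hb k => by rw [add_dotProduct, ha k, hb k, add_zero]
      zero_mem' := fun k => zero_dotProduct _
      smul_mem' := fun c y hy k => by rw [smul_dotProduct, hy k, smul_zero] }
  have hW : ∀ y ∈ W, A.vecMulLinear y ∈ W := fun y hy k => by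
    rw [Matrix.vecMulLinear_apply, ← Matrix.dotProduct_mulVec, Matrix.mulVec_mulVec, ← pow_succ']
    exact hy (k + 1)
  have hnt : Nontrivial W := ⟨⟨⟨z, hz2⟩, 0, fun h0 => hz0 (congrArg Subtype.val h0)⟩⟩
  obtain ⟨μ, hμ⟩ := Module.End.exists_eigenvalue (A.vecMulLinear.restrict hW)
  obtain ⟨y, hy⟩ := hμ.exists_hasEigenvector
  refine ⟨y, fun h0 => hy.2 (Subtype.ext h0), ⟨μ, ?_⟩, ?_⟩
  · exact congrArg Subtype.val hy.apply_eq_smul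
  · simpa using y.2 0

/-- Local uniqueness for linear systems `g' = g B` with bounded coefficients. -/
theorem eq_zero_near_of_linear {ι κ : Type*} [Fintype ι] [Fintype κ] {l : ℝ} (hl : 0 < l)
    {g : ℝ → Matrix ι κ ℂ} {B : ℝ → Matrix κ κ ℂ}
    (hg : HasACDerivOn (Ico 0 l) g fun x => g x * B x) (h0 : g 0 = 0)
    (hB : ∃ ε : ℝ, 0 < ε ∧ ∃ C : ℝ, ∀ x ∈ Ioo 0 ε, ∀ i j, ‖B x i j‖ ≤ C) :
    ∃ δ : ℝ, 0 < δ ∧ δ ≤ l ∧ ∀ x ∈ Ico 0 δ, g x = 0 := by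
  obtain ⟨ε, hε, C, hC⟩ := hB
  set K : ℝ := Fintype.card ι * Fintype.card κ with hK
  have hK0 : 0 ≤ K := by positivity
  -- The last bound forces `K |C| δ ≤ 1 / 2`; the `+ 1` guards against a zero denominator.
  set δ : ℝ := min (l / 2) (min (ε / 2) (1 / (2 * (K * |C| + 1)))) with hδ
  have hden : 0 < K * |C| + 1 := by positivity
  have hδ0 : 0 < δ := by
    simp only [hδ, lt_min_iff]
    exact ⟨by positivity, by positivity, by positivity⟩
  have hδl : δ < l := (min_le_left _ _).trans_lt (by linarith)
  have hδε : δ < ε := ((min_le_right _ _).trans (min_le_left _ _)).trans_lt (by linarith)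
  have hδC : K * |C| * δ < 1 := by
    have h1 : δ ≤ 1 / (2 * (K * |C| + 1)) := (min_le_right _ _).trans (min_le_right _ _)
    have h2 : K * |C| * δ ≤ (K * |C| + 1) * (1 / (2 * (K * |C| + 1))) :=
      mul_le_mul (by linarith) h1 hδ0.le hden.le
    have h3 : (K * |C| + 1) * (1 / (2 * (K * |C| + 1))) = 1 / 2 := by field_simp
    linarith
  set φ : ℝ → ℝ := fun x => ∑ i, ∑ j, ‖g x i j‖ with hφ
  have hφ0 : ∀ x, 0 ≤ φ x := fun x => by positivity
  have hle : ∀ x i j, ‖g x i j‖ ≤ φ x := fun x i j =>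
    (Finset.single_le_sum (f := fun j => ‖g x i j‖) (fun _ _ => norm_nonneg _)
      (Finset.mem_univ j)).trans
      (Finset.single_le_sum (f := fun i => ∑ j, ‖g x i j‖)
        (fun _ _ => Finset.sum_nonneg fun _ _ => norm_nonneg _) (Finset.mem_univ i))
  have hcont : ContinuousOn φ (Icc 0 δ) := by
    refine continuousOn_finsetSum _ fun i _ => continuousOn_finsetSum _ fun j _ => ?_
    have := (hg.1 i j 0 ⟨le_rfl, hl⟩ δ ⟨hδ0.le, hδl⟩).continuousOn
    rw [uIcc_of_le hδ0.le] at this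
    exact this.norm
  obtain ⟨t, ht, hmax⟩ := isCompact_Icc.exists_isMaxOn (nonempty_Icc.2 hδ0.le) hcont
  -- At the point `t` where the entry sum `φ` is maximal on `[0, δ]`, integrating the equation gives
  -- `φ t ≤ K |C| δ φ t`, so `φ t = 0`.
  have hgt : ∀ i j, ‖g t i j‖ ≤ |C| * φ t * δ := by
    intro i j
    have h1 := norm_sub_le_of_ae_norm_deriv_le (f := fun x => g x i j)
      (F := fun x => (g x * B x) i j) (C := |C| * φ t) ht.1
      (hg.1 i j 0 ⟨le_rfl, hl⟩ t ⟨ht.1, ht.2.trans_lt hδl⟩) (by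
        filter_upwards [(ae_restrict_iff' measurableSet_Ico).1 (hg.2 i j)] with x hx hm
        exact hx ⟨hm.1.le, hm.2.trans_le (ht.2.trans hδl.le)⟩) (fun x hx => by
        rw [Matrix.mul_apply]
        refine (norm_sum_le _ _).trans ?_
        have hxφ : ∑ k, ‖g x i k‖ ≤ φ t :=
          (Finset.single_le_sum (f := fun i => ∑ j, ‖g x i j‖)
            (fun _ _ => Finset.sum_nonneg fun _ _ => norm_nonneg _) (Finset.mem_univ i)).trans
            (hmax ⟨hx.1.le, hx.2.le.trans ht.2⟩)
        refine le_trans ?_ (mul_le_mul_of_nonneg_left hxφ (abs_nonneg C))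
        rw [Finset.mul_sum]
        refine Finset.sum_le_sum fun k _ => ?_
        rw [norm_mul, mul_comm]
        exact mul_le_mul_of_nonneg_right
          ((hC x ⟨hx.1, hx.2.trans (ht.2.trans_lt hδε)⟩ k j).trans (le_abs_self C))
          (norm_nonneg _))
    simp only [h0, Matrix.zero_apply, sub_zero] at h1
    exact h1.trans (mul_le_mul_of_nonneg_left ht.2 (mul_nonneg (abs_nonneg C) (hφ0 t)))
  have hφt : φ t ≤ K * |C| * δ * φ t := by
    calc φ t ≤ ∑ _i : ι, ∑ _j : κ, |C| * φ t * δ :=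
          Finset.sum_le_sum fun i _ => Finset.sum_le_sum fun j _ => hgt i j
      _ = K * |C| * δ * φ t := by
          simp only [Finset.sum_const, Finset.card_univ, nsmul_eq_mul, hK]
          ring
  have hφt0 : φ t = 0 := by
    by_contra hne
    have : 0 < φ t := lt_of_le_of_ne (hφ0 t) (Ne.symm hne)
    nlinarith
  refine ⟨δ, hδ0, hδl.le, fun x hx => ?_⟩
  ext i j
  have := (hle x i j).trans (hmax ⟨hx.1, hx.2.le⟩)
  rw [hφt0] at this
  exact norm_le_zero_iff.1 this

/-- A left eigenvector of `A` annihilating the initial values `Π(0)` and `S(0)` forces `S` to be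
singular near `0`. -/
theorem not_posDef_of_left_eigenvector {α : Type*} [Fintype α] {l : ℝ} (hl : 0 < l)
    {A : Matrix α α ℂ} {q0 : ℝ → Matrix (Fin 2) (Fin 2) ℂ} (hq0 : BoundedNearZero q0)
    {P : ℝ → Matrix α (Fin 2) ℂ} {S : ℝ → Matrix α α ℂ}
    (hP : HasACDerivOn (Ico 0 l) P (fun x => A * P x * q1 + P x * q0 x))
    (hS : HasACDerivOn (Ico 0 l) S (fun x => P x * (P x).conjTranspose))
    {Y : Matrix Unit α ℂ} (hY : Y ≠ 0) {μ : ℂ} (hYA : Y * A = μ • Y) (hYP : Y * P 0 = 0)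
    (hYS : Y * S 0 = 0) : ∃ x ∈ Ioo 0 l, ¬ (S x).PosDef := by
  classical
  -- The eigenvector relation makes `Y Π` satisfy a closed linear system with zero initial value.
  have hG : HasACDerivOn (Ico 0 l) (fun x => Y * P x)
      (fun x => (Y * P x) * (μ • q1 + q0 x)) :=
    (hP.const_mul Y).congr_deriv (fun x _ => by
      rw [Matrix.mul_add, Matrix.mul_add, ← Matrix.mul_assoc, ← Matrix.mul_assoc, hYA,
        Matrix.smul_mul, Matrix.smul_mul, Matrix.mul_smul, ← Matrix.mul_assoc]) measurableSet_Ico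
  obtain ⟨ε, hε, C, hC⟩ := hq0
  obtain ⟨δ, hδ, hδl, hz⟩ := eq_zero_near_of_linear hl hG hYP
    ⟨ε, hε, (∑ i, ∑ j, ‖(μ • q1) i j‖) + C, fun x hx i j => by
      refine (norm_add_le _ _).trans (add_le_add ?_ (hC x hx i j))
      exact (Finset.single_le_sum (f := fun j => ‖(μ • q1) i j‖) (fun _ _ => norm_nonneg _)
        (Finset.mem_univ j)).trans
        (Finset.single_le_sum (f := fun i => ∑ j, ‖(μ • q1) i j‖)
          (fun _ _ => Finset.sum_nonneg fun _ _ => norm_nonneg _) (Finset.mem_univ i))⟩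
  have hS0 : HasACDerivOn (Ico 0 δ) (fun x => Y * S x) (fun _ => 0) :=
    ((hS.mono (Ico_subset_Ico_right hδl)).const_mul Y).congr_deriv (fun x hx => by
      rw [← Matrix.mul_assoc, hz x hx, Matrix.zero_mul]) measurableSet_Ico
  refine ⟨δ / 2, ⟨by positivity, by linarith⟩, fun hpos => hY ?_⟩
  have h1 : Y * S (δ / 2) = 0 := by
    rw [hS0.eq_of_deriv_zero hδ ⟨by positivity, by linarith⟩, hYS]
  have h2 : Y * S (δ / 2) * (S (δ / 2))⁻¹ = 0 := by rw [h1, Matrix.zero_mul]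
  rwa [Matrix.mul_assoc, Matrix.mul_nonsing_inv _ (isUnit_iff_ne_zero.2 hpos.det_pos.ne'),
    Matrix.mul_one] at h2

/-- Since the lower left block is `ψ r`, a left eigenvector of `A₂` orthogonal to `ψ`, padded by
zeros, is a left eigenvector of the whole block matrix and kills both initial values. -/
theorem krylov_det_ne_zero {m n : ℕ} {l : ℝ} (hl : 0 < l)
    {A₁ S₁ : Matrix (Fin m) (Fin m) ℂ} {A₂ : Matrix (Fin n) (Fin n) ℂ} {ψ : Fin n → ℂ}
    {r : Fin m → ℂ} {h : Fin 2 → ℂ} {Ψ₁ : Matrix (Fin m) (Fin 2) ℂ}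
    {q0 : ℝ → Matrix (Fin 2) (Fin 2) ℂ} (hq0 : BoundedNearZero q0)
    {P : ℝ → Matrix (Fin m ⊕ Fin n) (Fin 2) ℂ}
    {S : ℝ → Matrix (Fin m ⊕ Fin n) (Fin m ⊕ Fin n) ℂ}
    (hP : HasACDerivOn (Ico 0 l) P (fun x =>
      Matrix.fromBlocks A₁ 0 (Matrix.vecMulVec ψ r) A₂ * P x * q1 + P x * q0 x))
    (hS : HasACDerivOn (Ico 0 l) S (fun x => P x * (P x).conjTranspose))
    (hP0 : P 0 = Matrix.fromRows Ψ₁ (Matrix.vecMulVec ψ h))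
    (hS0 : S 0 = Matrix.fromBlocks S₁ 0 0 0) (hpos : ∀ x ∈ Ioo 0 l, (S x).PosDef) :
    (krylov A₂ ψ).det ≠ 0 := by
  intro hdet
  obtain ⟨y, hy0, ⟨μ, hyA⟩, hyψ⟩ := exists_left_eigenvector_of_krylov_det_eq_zero hdet
  have hyv : ∀ {k : Type} (v : k → ℂ),
      Matrix.of (fun _ : Unit => y) * Matrix.vecMulVec ψ v = 0 := by
    intro k v
    ext i j
    have : ∑ x, y x * (ψ x * v j) = dotProduct y ψ * v j := by
      rw [dotProduct, Finset.sum_mul]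
      exact Finset.sum_congr rfl fun x _ => (mul_assoc _ _ _).symm
    simp only [Matrix.mul_apply, Matrix.of_apply, Matrix.vecMulVec_apply, this, hyψ, zero_mul,
      Matrix.zero_apply]
  obtain ⟨x, hx, hn⟩ := not_posDef_of_left_eigenvector hl hq0 hP hS
    (Y := Matrix.fromCols 0 (Matrix.of fun _ => y)) (μ := μ) (fun h0 => hy0 (by
      ext k
      exact congrFun (congrFun h0 ()) (Sum.inr k))) (by
      rw [Matrix.fromCols_mul_fromBlocks, hyv]
      ext i j
      rcases j with j | j
      · simp
      · have := congrFun hyA j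
        simpa [Matrix.mul_apply, Matrix.vecMul, dotProduct] using this) (by
      rw [hP0, Matrix.fromCols_mul_fromRows, hyv, Matrix.zero_mul, zero_add]) (by
      rw [hS0, Matrix.fromCols_mul_fromBlocks]
      simp)
  exact hn (hpos x hx)

/-! ### Asymptotics at the singular end point -/

theorem isBigO_pow_pow_nhdsGT {a b : ℕ} (h : a ≤ b) :
    (fun x : ℝ => x ^ b) =O[𝓝[>] 0] fun x : ℝ => x ^ a := by
  refine IsBigO.of_bound 1 ?_
  filter_upwards [Ioo_mem_nhdsGT (zero_lt_one (α := ℝ))] with x hx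
  rw [one_mul, Real.norm_of_nonneg (pow_nonneg hx.1.le _),
    Real.norm_of_nonneg (pow_nonneg hx.1.le _)]
  exact pow_le_pow_of_le_one hx.1.le hx.2.le h

theorem isBigO_entries_mul {α β γ : Type*} [Fintype β] {M : ℝ → Matrix α β ℂ}
    {N : ℝ → Matrix β γ ℂ} {f g : ℝ → ℝ} {i : α} {j : γ}
    (hM : ∀ k, (fun x => M x i k) =O[𝓝[>] 0] f) (hN : ∀ k, (fun x => N x k j) =O[𝓝[>] 0] g) :
    (fun x => (M x * N x) i j) =O[𝓝[>] 0] fun x => f x * g x := by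
  simp only [Matrix.mul_apply]
  exact IsBigO.fun_sum fun k _ => (hM k).mul (hN k)

theorem isBigO_entries_mul_one {α β γ : Type*} [Fintype β] {M : ℝ → Matrix α β ℂ}
    {N : ℝ → Matrix β γ ℂ} {f : ℝ → ℝ} {i : α} {j : γ}
    (hM : ∀ k, (fun x => M x i k) =O[𝓝[>] 0] f)
    (hN : ∀ k, (fun x => N x k j) =O[𝓝[>] 0] fun _ => (1 : ℝ)) :
    (fun x => (M x * N x) i j) =O[𝓝[>] 0] f := by
  simpa using isBigO_entries_mul hM hN

theorem isBigO_entries_one_mul {α β γ : Type*} [Fintype β] {M : ℝ → Matrix α β ℂ}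
    {N : ℝ → Matrix β γ ℂ} {f : ℝ → ℝ} {i : α} {j : γ}
    (hM : ∀ k, (fun x => M x i k) =O[𝓝[>] 0] fun _ => (1 : ℝ))
    (hN : ∀ k, (fun x => N x k j) =O[𝓝[>] 0] f) :
    (fun x => (M x * N x) i j) =O[𝓝[>] 0] f := by
  simpa using isBigO_entries_mul hM hN

theorem isBigO_const_one (c : ℂ) : (fun _ : ℝ => c) =O[𝓝[>] 0] fun _ => (1 : ℝ) :=
  isBigO_const_const c one_ne_zero _

theorem boundedNearZero_iff {M : ℝ → Matrix (Fin 2) (Fin 2) ℂ} :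
    BoundedNearZero M ↔ ∀ i j, (fun x => M x i j) =O[𝓝[>] 0] fun _ => (1 : ℝ) := by
  constructor
  · rintro ⟨ε, hε, C, hC⟩ i j
    refine IsBigO.of_bound C ?_
    filter_upwards [Ioo_mem_nhdsGT hε] with x hx
    simpa using hC x hx i j
  · intro h
    have h1 : ∀ i j, ∃ C : ℝ, ∀ᶠ x in 𝓝[>] (0 : ℝ), ‖M x i j‖ ≤ C := fun i j => by
      obtain ⟨C, hC⟩ := (h i j).bound
      exact ⟨C, by simpa using hC⟩
    choose C hC using h1
    have h2 : ∀ᶠ x in 𝓝[>] (0 : ℝ), ∀ i j, ‖M x i j‖ ≤ C i j :=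
      eventually_all.2 fun i => eventually_all.2 fun j => hC i j
    obtain ⟨ε, hε, hs⟩ := mem_nhdsGT_iff_exists_Ioo_subset.1 h2
    refine ⟨ε, hε, ∑ i, ∑ j, |C i j|, fun x hx i j => (hs hx i j).trans ?_⟩
    exact (le_abs_self _).trans ((Finset.single_le_sum (f := fun j => |C i j|)
      (fun _ _ => abs_nonneg _) (Finset.mem_univ j)).trans
      (Finset.single_le_sum (f := fun i => ∑ j, |C i j|)
        (fun _ _ => Finset.sum_nonneg fun _ _ => abs_nonneg _) (Finset.mem_univ i)))

section Rows

variable {n : ℕ} {l : ℝ} {C : Matrix (Fin n) (Fin n) ℂ} {q0 : ℝ → Matrix (Fin 2) (Fin 2) ℂ}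
  {Q E : ℝ → Matrix (Fin n) (Fin 2) ℂ} {h : Fin 2 → ℂ}

/-- `C` is a companion matrix with free last column, so the derivative of row `k` involves only rows
`k - 1` and beyond. The induction on `p` bootstraps: each pass gains one order, up to the order `k`
for row `k`. -/
theorem isBigO_row_min (hl : 0 < l)
    (hq0 : ∀ i j, (fun x => q0 x i j) =O[𝓝[>] 0] fun _ => (1 : ℝ))
    (hC : ∀ k j : Fin n, (j : ℕ) + 1 < n → C k j = if (k : ℕ) = j + 1 then 1 else 0)
    (hE : ∀ k : Fin n, 0 < (k : ℕ) → ∀ x b, E x k b = 0)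
    (hQ : HasACDerivOn (Ico 0 l) Q fun x => C * Q x * q1 + Q x * q0 x + E x)
    (hQ0 : ∀ k : Fin n, 0 < (k : ℕ) → Q 0 k = 0) (p : ℕ) :
    ∀ (k : Fin n) b, (fun x => Q x k b) =O[𝓝[>] 0] fun x : ℝ => x ^ (min p k) := by
  have hQ1 : ∀ k b, (fun x => Q x k b) =O[𝓝[>] 0] fun _ => (1 : ℝ) :=
    fun k b => (hasACDerivOn_iff.1 hQ k b).isBigO_one hl
  induction p with
  | zero => simpa using hQ1
  | succ p ih =>
    intro k b
    rcases Nat.eq_zero_or_pos (k : ℕ) with hk | hk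
    · simpa [hk] using hQ1 k b
    have e : min (p + 1) (k : ℕ) = min p (k - 1) + 1 := by omega
    rw [e]
    refine (hasACDerivOn_iff.1 hQ k b).isBigO hl (by simp [hQ0 k hk]) ?_
    simp only [Matrix.add_apply, hE k hk, add_zero]
    refine IsBigO.add (isBigO_entries_mul_one (fun c => ?_) fun c => isBigO_const_one _)
      (isBigO_entries_mul_one (fun c => (ih k c).trans (isBigO_pow_pow_nhdsGT (by omega)))
        fun c => hq0 _ _)
    simp only [Matrix.mul_apply]
    refine IsBigO.fun_sum fun j _ => ?_
    by_cases hj : (k : ℕ) ≤ j + 1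
    · exact ((ih j c).trans (isBigO_pow_pow_nhdsGT (by omega))).const_mul_left _
    · rw [hC k j (by omega), if_neg (by omega)]
      simpa using isBigO_zero _ _

/-- To leading order the derivative of row `k + 1` is row `k` times `q₁`. The `q₀` term and the last
column of `C` are one power smaller, and the forcing `E` enters only row `0`. -/
theorem isBigO_row_sub_leadingRow (hl : 0 < l)
    (hq0 : ∀ i j, (fun x => q0 x i j) =O[𝓝[>] 0] fun _ => (1 : ℝ))
    (hC : ∀ k j : Fin n, (j : ℕ) + 1 < n → C k j = if (k : ℕ) = j + 1 then 1 else 0)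
    (hE : ∀ k : Fin n, 0 < (k : ℕ) → ∀ x b, E x k b = 0)
    (hE1 : ∀ k b, (fun x => E x k b) =O[𝓝[>] 0] fun _ => (1 : ℝ))
    (hQ : HasACDerivOn (Ico 0 l) Q fun x => C * Q x * q1 + Q x * q0 x + E x)
    (hQ0 : ∀ k : Fin n, Q 0 k = if (k : ℕ) = 0 then h else 0) (k : ℕ) :
    ∀ (hk : k < n) b, (fun x => Q x ⟨k, hk⟩ b - leadingRow h k b * (x : ℂ) ^ k)
      =O[𝓝[>] 0] fun x : ℝ => x ^ (k + 1) := by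
  have hQ1 : ∀ k b, (fun x => Q x k b) =O[𝓝[>] 0] fun _ => (1 : ℝ) :=
    fun k b => (hasACDerivOn_iff.1 hQ k b).isBigO_one hl
  have hmin := isBigO_row_min hl hq0 hC hE hQ (fun k hk => by rw [hQ0, if_neg hk.ne'])
  induction k with
  | zero =>
    intro hk b
    have hd := (hasACDerivOn_iff.1 hQ ⟨0, hk⟩ b).sub (HasACDeriv.const _ (h b))
    refine (hd.isBigO (k := 0) hl (by simp [hQ0]) ?_).congr_left fun x => by simp [leadingRow]
    simp only [Matrix.add_apply, sub_zero, pow_zero]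
    refine IsBigO.add (IsBigO.add (isBigO_entries_mul_one (fun c => isBigO_entries_one_mul
      (fun j => isBigO_const_one _) fun j => hQ1 _ _) fun c => isBigO_const_one _)
      (isBigO_entries_mul_one (fun c => hQ1 _ _) fun c => hq0 _ _)) (hE1 _ _)
  | succ k ih =>
    intro hk b
    have hk' : k < n := by omega
    have key := (hasACDerivOn_iff.1 hQ ⟨k + 1, hk⟩ b).isBigO_sub hl (k := k)
      (c := Matrix.vecMul (leadingRow h k) q1 b) (by simp [hQ0]) ?_
    · refine key.congr_left fun x => ?_
      simp only [leadingRow, Pi.smul_apply, smul_eq_mul]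
      ring
    simp only [Matrix.add_apply, hE ⟨k + 1, hk⟩ (Nat.succ_pos k), add_zero]
    have e : ∀ x : ℝ, (C * Q x * q1) ⟨k + 1, hk⟩ b + (Q x * q0 x) ⟨k + 1, hk⟩ b -
        Matrix.vecMul (leadingRow h k) q1 b * (x : ℂ) ^ k =
        ∑ c, ((Q x ⟨k, hk'⟩ c - leadingRow h k c * (x : ℂ) ^ k) +
          ∑ j, (C ⟨k + 1, hk⟩ j - if j = ⟨k, hk'⟩ then 1 else 0) * Q x j c) * q1 c b +
        (Q x * q0 x) ⟨k + 1, hk⟩ b := by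
      intro x
      have e1 : ∀ c, ∑ j, (C ⟨k + 1, hk⟩ j - if j = ⟨k, hk'⟩ then 1 else 0) * Q x j c =
          (C * Q x) ⟨k + 1, hk⟩ c - Q x ⟨k, hk'⟩ c := by
        intro c
        simp only [sub_mul, Finset.sum_sub_distrib, Matrix.mul_apply, ite_mul, one_mul, zero_mul,
          Finset.sum_ite_eq', Finset.mem_univ, if_true]
      simp only [e1]
      rw [Matrix.mul_apply (M := C * Q x), Matrix.vecMul, dotProduct, Finset.sum_mul,
        add_sub_right_comm, ← Finset.sum_sub_distrib]
      congr 1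
      refine Finset.sum_congr rfl fun c _ => ?_
      ring
    simp only [e]
    refine IsBigO.add (IsBigO.fun_sum fun c _ => ?_) (isBigO_entries_mul_one (fun c => by
      simpa using hmin (k + 1) ⟨k + 1, hk⟩ c) fun c => hq0 _ _)
    refine (IsBigO.mul (IsBigO.add (ih hk' c) (IsBigO.fun_sum fun j _ => ?_))
      (isBigO_const_one (q1 c b))).trans (by simpa using isBigO_refl _ _)
    by_cases hj : (j : ℕ) + 1 < n
    · rw [hC _ j hj]
      have : (if k + 1 = (j : ℕ) + 1 then (1 : ℂ) else 0) - (if j = ⟨k, hk'⟩ then 1 else 0) = 0 := by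
        by_cases hjk : (j : ℕ) = k
        · rw [if_pos (by omega), if_pos (Fin.ext hjk), sub_self]
        · rw [if_neg (by omega), if_neg (fun h => hjk (congrArg Fin.val h)), sub_self]
      simp only [this, zero_mul]
      exact isBigO_zero _ _
    -- Here `j` is the last index, so its row is `O(x ^ (n - 1))`, and `k + 1 ≤ n - 1`.
    · refine IsBigO.const_mul_left ((hmin n j c).trans (isBigO_pow_pow_nhdsGT ?_)) _
      have := j.2
      omega

end Rows

/-! ### Rescaling and the limit of `x X(x)` -/

theorem isBigO_inv_pow_mul {f : ℝ → ℂ} {p : ℕ}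
    (hf : f =O[𝓝[>] 0] fun x : ℝ => x ^ (p + 1)) :
    (fun x : ℝ => ((x : ℂ) ^ p)⁻¹ * f x) =O[𝓝[>] 0] fun x : ℝ => x := by
  have h1 : (fun x : ℝ => ((x : ℂ) ^ p)⁻¹) =O[𝓝[>] 0] fun x : ℝ => (x ^ p)⁻¹ :=
    IsBigO.of_bound 1 (Eventually.of_forall fun x => by simp)
  refine (h1.mul hf).trans (EventuallyEq.isBigO ?_)
  filter_upwards [self_mem_nhdsWithin] with x hx
  have : x ^ p ≠ 0 := pow_ne_zero _ (ne_of_gt hx)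
  field_simp
  ring

theorem isBigO_inv_pow_mul_sub {f : ℝ → ℂ} {p : ℕ} {c : ℂ}
    (hf : (fun x : ℝ => f x - c * (x : ℂ) ^ p) =O[𝓝[>] 0] fun x : ℝ => x ^ (p + 1)) :
    (fun x : ℝ => ((x : ℂ) ^ p)⁻¹ * f x - c) =O[𝓝[>] 0] fun x : ℝ => x := by
  refine (isBigO_inv_pow_mul hf).congr' ?_ EventuallyEq.rfl
  filter_upwards [self_mem_nhdsWithin] with x hx
  have : (x : ℂ) ^ p ≠ 0 := pow_ne_zero _ (by exact_mod_cast ne_of_gt hx)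
  rw [mul_sub, mul_comm c, inv_mul_cancel_left₀ this]

theorem isBigO_inv_entries {α : Type*} [Fintype α] [DecidableEq α] {Z : ℝ → Matrix α α ℂ}
    {Z₀ : Matrix α α ℂ} (hZ : ∀ i j, (fun x => Z x i j - Z₀ i j) =O[𝓝[>] 0] fun x : ℝ => x)
    (hdet : Z₀.det ≠ 0) (i j : α) :
    (fun x => (Z x)⁻¹ i j) =O[𝓝[>] 0] fun _ => (1 : ℝ) := by
  have ht : Tendsto Z (𝓝[>] 0) (𝓝 Z₀) := by
    refine tendsto_pi_nhds.2 fun i => tendsto_pi_nhds.2 fun j => ?_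
    have h0 : Tendsto (fun x : ℝ => x) (𝓝[>] 0) (𝓝 0) := tendsto_id.mono_left nhdsWithin_le_nhds
    exact tendsto_sub_nhds_zero_iff.1 ((hZ i j).trans_tendsto h0)
  have h1 : Tendsto (fun x => (Z x).det) (𝓝[>] 0) (𝓝 Z₀.det) :=
    ((continuous_id.matrix_det).tendsto Z₀).comp ht
  have h2 : Tendsto (fun x => (Z x).adjugate i j) (𝓝[>] 0) (𝓝 (Z₀.adjugate i j)) :=
    (((continuous_id.matrix_adjugate).matrix_elem i j).tendsto Z₀).comp ht
  refine (((h1.inv₀ hdet).mul h2).isBigO_one ℝ).congr_left fun x => ?_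
  rw [Matrix.inv_def, Ring.inverse_eq_inv', Matrix.smul_apply, smul_eq_mul]

/-- The order of vanishing at `0` of the rows of `Π` in Krylov coordinates. -/
def rowOrder {m n : ℕ} : Fin m ⊕ Fin n → ℕ := Sum.elim (fun _ => 0) fun k => k

/-- Scaling `S` by suitable powers of `x` gives a matrix with invertible limit `Z₀`. The error
`O(x)`, rather than mere convergence, is what later makes the remainder of `X` bounded after
division by `x`. -/
theorem isBigO_mul_gram_sub {m n : ℕ} {S₁ : Matrix (Fin m) (Fin m) ℂ}
    {Ψ₁ : Matrix (Fin m) (Fin 2) ℂ} {V : Matrix (Fin n) (Fin 2) ℂ}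
    {Q : ℝ → Matrix (Fin m ⊕ Fin n) (Fin 2) ℂ}
    {S : ℝ → Matrix (Fin m ⊕ Fin n) (Fin m ⊕ Fin n) ℂ}
    (hQ : ∀ a b, (fun x => Q x a b - Matrix.fromRows Ψ₁ V a b * (x : ℂ) ^ rowOrder a)
      =O[𝓝[>] 0] fun x : ℝ => x ^ (rowOrder a + 1))
    (hS : ∀ a b, (fun x => S x a b - Matrix.fromBlocks S₁ 0 0 0 a b -
        (Matrix.fromRows Ψ₁ V * (Matrix.fromRows Ψ₁ V).conjTranspose) a b *
          (x : ℂ) ^ (rowOrder a + rowOrder b + 1) / ((rowOrder a + rowOrder b : ℕ) + 1))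
      =O[𝓝[>] 0] fun x : ℝ => x ^ (rowOrder a + rowOrder b + 2))
    (hdet : ∀ᶠ x in 𝓝[>] (0 : ℝ), (S x).det ≠ 0) (hS₁ : S₁.det ≠ 0)
    (hH : (cauchyGram V).det ≠ 0) (i j : Fin 2) :
    (fun x : ℝ => (x : ℂ) * ((Q x).conjTranspose * (S x)⁻¹ * Q x) i j -
      (V.conjTranspose * (cauchyGram V)⁻¹ * V) i j) =O[𝓝[>] 0] fun x : ℝ => x := by
  set G := Matrix.fromRows Ψ₁ V * (Matrix.fromRows Ψ₁ V).conjTranspose with hG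
  set H := cauchyGram V with hHdef
  -- The left and right scalings differ by one power, so that `x ^ (-(j + k + 1))` is split without
  -- square roots. The price is that the limit `Z₀` is only block triangular; its corner `B₀` does
  -- not affect the result.
  let e₁ : ℝ → Fin m ⊕ Fin n → ℂ := fun x =>
    Sum.elim (fun _ => 1) fun k => ((x : ℂ) ^ ((k : ℕ) + 1))⁻¹
  let e₂ : ℝ → Fin m ⊕ Fin n → ℂ := fun x =>
    Sum.elim (fun _ => 1) fun k => ((x : ℂ) ^ (k : ℕ))⁻¹
  let Z : ℝ → Matrix (Fin m ⊕ Fin n) (Fin m ⊕ Fin n) ℂ := fun x =>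
    Matrix.diagonal (e₁ x) * S x * Matrix.diagonal (e₂ x)
  let B₀ : Matrix (Fin n) (Fin m) ℂ := Matrix.of fun k i => G (Sum.inr k) (Sum.inl i) / ((k : ℕ) + 1)
  let Z₀ := Matrix.fromBlocks S₁ 0 B₀ H
  let Y₁ : ℝ → Matrix (Fin m ⊕ Fin n) (Fin 2) ℂ := fun x =>
    (x : ℂ) • (Matrix.diagonal (e₁ x) * Q x)
  let Y₂ : ℝ → Matrix (Fin m ⊕ Fin n) (Fin 2) ℂ := fun x => Matrix.diagonal (e₂ x) * Q x
  -- `U` solves `Z₀ U = (0; V)`; it appears explicitly instead of `Z₀⁻¹`.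
  let U : Matrix (Fin m ⊕ Fin n) (Fin 2) ℂ := Matrix.fromRows 0 (H⁻¹ * V)
  have hZent : ∀ x a b, Z x a b = e₁ x a * S x a b * e₂ x b := fun x a b => by
    simp only [Z, Matrix.mul_diagonal, Matrix.diagonal_mul]
  have hpow : ∀ (c d : ℂ) (k : ℕ), (fun x : ℝ => c * (x : ℂ) ^ k / d)
      =O[𝓝[>] 0] fun x : ℝ => x ^ k := by
    intro c d k
    have : (fun x : ℝ => (x : ℂ) ^ k) =O[𝓝[>] 0] fun x : ℝ => x ^ k :=
      IsBigO.of_bound 1 (Eventually.of_forall fun x => by simp)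
    refine (this.const_mul_left (c / d)).congr_left fun x => by ring
  have hS' : ∀ a b, (fun x => S x a b - Matrix.fromBlocks S₁ 0 0 0 a b) =O[𝓝[>] 0]
      fun x : ℝ => x ^ (rowOrder a + rowOrder b + 1) := fun a b =>
    (((hS a b).trans (isBigO_pow_pow_nhdsGT (Nat.le_succ _))).add (hpow (G a b) _ _)).congr_left
      fun x => sub_add_cancel _ _
  have hZ : ∀ a b, (fun x => Z x a b - Z₀ a b) =O[𝓝[>] 0] fun x : ℝ => x := by
    intro a b
    simp only [hZent]
    rcases a with a | a <;> rcases b with b | b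
    · simpa [e₁, e₂, Z₀, rowOrder] using hS' (Sum.inl a) (Sum.inl b)
    · have := hS' (Sum.inl a) (Sum.inr b)
      simp only [rowOrder, Sum.elim_inl, Sum.elim_inr, Matrix.fromBlocks_apply₁₂,
        Matrix.zero_apply, sub_zero, zero_add] at this
      refine (isBigO_inv_pow_mul this).congr_left fun x => ?_
      simp [e₁, e₂, Z₀, mul_comm]
    · have := hS (Sum.inr a) (Sum.inl b)
      simp only [rowOrder, Sum.elim_inl, Sum.elim_inr, Matrix.fromBlocks_apply₂₁,
        Matrix.zero_apply, sub_zero, add_zero] at this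
      refine (isBigO_inv_pow_mul_sub (p := a + 1) (c := G (Sum.inr a) (Sum.inl b) / ((a : ℕ) + 1))
        (this.congr_left fun x => by ring)).congr_left fun x => ?_
      simp [e₁, e₂, Z₀, B₀]
    · have := hS (Sum.inr a) (Sum.inr b)
      simp only [rowOrder, Sum.elim_inr, Matrix.fromBlocks_apply₂₂,
        Matrix.zero_apply, sub_zero] at this
      refine (isBigO_inv_pow_mul_sub (p := a + b + 1)
        (c := G (Sum.inr a) (Sum.inr b) / (((a + b : ℕ) : ℂ) + 1))
        (this.congr_left fun x => by ring)).congr_left fun x => ?_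
      have hGab : G (Sum.inr a) (Sum.inr b) = (V * V.conjTranspose) a b := by
        rw [hG, Matrix.mul_apply, Matrix.mul_apply]
        rfl
      simp only [e₁, e₂, Z₀, Sum.elim_inr, Matrix.fromBlocks_apply₂₂, hHdef, cauchyGram,
        Matrix.of_apply, hGab]
      push_cast
      rw [show (a : ℕ) + b + 1 = (a + 1) + b by ring, pow_add _ ((a : ℕ) + 1), mul_inv]
      ring
  have hZ₀det : Z₀.det ≠ 0 := by
    rw [Matrix.det_fromBlocks_zero₁₂]
    exact mul_ne_zero hS₁ hH
  have hZinv := isBigO_inv_entries hZ hZ₀det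
  have hY₁ : ∀ a b, (fun x => Y₁ x a b - Matrix.fromRows (0 : Matrix (Fin m) (Fin 2) ℂ) V a b)
      =O[𝓝[>] 0] fun x : ℝ => x := by
    intro a b
    rcases a with a | a
    · have h1 : (fun x => Q x (Sum.inl a) b) =O[𝓝[>] 0] fun _ => (1 : ℝ) := by
        refine ((((hQ (Sum.inl a) b).trans (isBigO_pow_pow_nhdsGT (Nat.zero_le _))).congr_right
          fun x => pow_zero x).add
          (isBigO_const_one (Ψ₁ a b))).congr_left fun x => ?_
        simp [rowOrder]
      have h2 : (fun x : ℝ => (x : ℂ)) =O[𝓝[>] 0] fun x : ℝ => x :=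
        IsBigO.of_bound 1 (Eventually.of_forall fun x => by simp)
      refine ((h2.mul h1).congr_right fun x => mul_one x).congr_left fun x => ?_
      simp [Y₁, e₁, Matrix.diagonal_mul]
    · refine (isBigO_inv_pow_mul_sub (hQ (Sum.inr a) b)).congr' ?_ EventuallyEq.rfl
      filter_upwards [self_mem_nhdsWithin] with x hx
      have hx0 : (x : ℂ) ≠ 0 := by exact_mod_cast ne_of_gt hx
      simp only [Y₁, e₁, Matrix.smul_apply, Matrix.diagonal_mul, Sum.elim_inr, rowOrder,
        Matrix.fromRows_apply_inr, smul_eq_mul, pow_succ]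
      field_simp
  have hY₂ : ∀ a b, (fun x => Y₂ x a b - Matrix.fromRows Ψ₁ V a b)
      =O[𝓝[>] 0] fun x : ℝ => x := by
    intro a b
    rcases a with a | a
    · refine (isBigO_inv_pow_mul_sub (hQ (Sum.inl a) b)).congr_left fun x => ?_
      simp [Y₂, e₂, Matrix.diagonal_mul, rowOrder]
    · refine (isBigO_inv_pow_mul_sub (hQ (Sum.inr a) b)).congr_left fun x => ?_
      simp [Y₂, e₂, Matrix.diagonal_mul, rowOrder]
  have hxO : (fun x : ℝ => x) =O[𝓝[>] 0] fun _ => (1 : ℝ) := by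
    simpa using isBigO_pow_pow_nhdsGT (Nat.zero_le 1)
  have hY₂O : ∀ a b, (fun x => (Y₂ x).conjTranspose b a) =O[𝓝[>] 0] fun _ => (1 : ℝ) := by
    intro a b
    have : (fun x => Y₂ x a b) =O[𝓝[>] 0] fun _ => (1 : ℝ) :=
      (((hY₂ a b).trans hxO).add (isBigO_const_one (Matrix.fromRows Ψ₁ V a b))).congr_left
        fun x => sub_add_cancel _ _
    exact (this.norm_left.congr_left fun x => (norm_star (Y₂ x a b)).symm).of_norm_left
  have hZU : Z₀ * U = Matrix.fromRows 0 V := by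
    have hdH : IsUnit H.det := isUnit_iff_ne_zero.2 hH
    simp only [Z₀, U, Matrix.fromBlocks_mul_fromRows, Matrix.mul_zero, Matrix.zero_mul, add_zero,
      zero_add]
    rw [← Matrix.mul_assoc, Matrix.mul_nonsing_inv _ hdH, Matrix.one_mul]
  have hVU : (Matrix.fromRows Ψ₁ V).conjTranspose * U = V.conjTranspose * H⁻¹ * V := by
    simp only [U]
    rw [Matrix.conjTranspose_fromRows_eq_fromCols_conjTranspose, Matrix.fromCols_mul_fromRows,
      Matrix.mul_zero, zero_add, Matrix.mul_assoc]
  -- The error is written as `Y₂* Z⁻¹ ((Y₁ - lim Y₁) - (Z - Z₀) U) + (Y₂ - lim Y₂)* U`, so only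
  -- boundedness of `Z⁻¹` is needed.
  have hmain : (fun x => ((Y₂ x).conjTranspose * ((Z x)⁻¹ *
      ((Y₁ x - Matrix.fromRows (0 : Matrix (Fin m) (Fin 2) ℂ) V) - (Z x - Z₀) * U))) i j +
      ((Y₂ x - Matrix.fromRows Ψ₁ V).conjTranspose * U) i j) =O[𝓝[>] 0] fun x : ℝ => x := by
    refine IsBigO.add (isBigO_entries_one_mul (fun a => hY₂O a i) fun a =>
      isBigO_entries_one_mul (fun b => hZinv a b) fun b => ?_) (isBigO_entries_mul_one (fun a => ?_)
        fun a => isBigO_const_one _)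
    · simp only [Matrix.sub_apply]
      exact (hY₁ b j).sub (isBigO_entries_mul_one (M := fun x => Z x - Z₀) (fun c => hZ b c)
        fun c => isBigO_const_one _)
    · exact ((hY₂ a i).norm_left.congr_left fun x => (norm_star _).symm).of_norm_left
  refine hmain.congr' ?_ EventuallyEq.rfl
  filter_upwards [self_mem_nhdsWithin, hdet] with x hx hd
  have hx0 : (x : ℂ) ≠ 0 := by exact_mod_cast ne_of_gt hx
  have hu₁ : IsUnit (Matrix.diagonal (e₁ x)).det := by
    rw [Matrix.det_diagonal, isUnit_iff_ne_zero]
    refine Finset.prod_ne_zero_iff.2 fun a _ => ?_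
    rcases a with a | a
    · exact one_ne_zero
    · exact inv_ne_zero (pow_ne_zero _ hx0)
  have hu₂ : IsUnit (Matrix.diagonal (e₂ x)).det := by
    rw [Matrix.det_diagonal, isUnit_iff_ne_zero]
    refine Finset.prod_ne_zero_iff.2 fun a _ => ?_
    rcases a with a | a
    · exact one_ne_zero
    · exact inv_ne_zero (pow_ne_zero _ hx0)
  have huS : IsUnit (S x).det := isUnit_iff_ne_zero.2 hd
  have huZ : IsUnit (Z x).det := by
    simp only [Z, Matrix.det_mul]
    exact (hu₁.mul huS).mul hu₂
  have hSinv : Matrix.diagonal (e₂ x) * (Z x)⁻¹ * Matrix.diagonal (e₁ x) = (S x)⁻¹ := by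
    simp only [Z, Matrix.mul_inv_rev]
    rw [← Matrix.mul_assoc, Matrix.mul_nonsing_inv _ hu₂, Matrix.one_mul, Matrix.mul_assoc,
      Matrix.nonsing_inv_mul _ hu₁, Matrix.mul_one]
  have he₂ : (Matrix.diagonal (e₂ x)).conjTranspose = Matrix.diagonal (e₂ x) := by
    rw [Matrix.diagonal_conjTranspose]
    congr 1
    ext a
    rcases a with a | a <;> simp [e₂]
  have hX : (x : ℂ) • ((Q x).conjTranspose * (S x)⁻¹ * Q x) =
      (Y₂ x).conjTranspose * ((Z x)⁻¹ * Y₁ x) := by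
    rw [← hSinv]
    simp only [Y₁, Y₂, Matrix.conjTranspose_mul, he₂, Matrix.mul_smul, Matrix.mul_assoc]
  have hfin : (Y₂ x).conjTranspose * ((Z x)⁻¹ *
      ((Y₁ x - Matrix.fromRows (0 : Matrix (Fin m) (Fin 2) ℂ) V) - (Z x - Z₀) * U)) +
      (Y₂ x - Matrix.fromRows Ψ₁ V).conjTranspose * U =
      (x : ℂ) • ((Q x).conjTranspose * (S x)⁻¹ * Q x) - V.conjTranspose * H⁻¹ * V := by
    have h1 : (Y₁ x - Matrix.fromRows 0 V) - (Z x - Z₀) * U = Y₁ x - Z x * U := by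
      rw [Matrix.sub_mul, hZU]
      abel
    rw [h1, Matrix.mul_sub, Matrix.nonsing_inv_mul_cancel_left _ _ huZ, hX,
      Matrix.conjTranspose_sub, Matrix.sub_mul, hVU, Matrix.mul_sub]
    abel
  exact congrFun (congrFun hfin i) j

/-! ### Krylov coordinates and the singular part of `X` -/

theorem krylov_companion {n : ℕ} {A : Matrix (Fin n) (Fin n) ℂ} {ψ : Fin n → ℂ}
    (h : IsUnit (krylov A ψ).det) (k j : Fin n) (hj : (j : ℕ) + 1 < n) :
    ((krylov A ψ)⁻¹ * A * krylov A ψ) k j = if (k : ℕ) = j + 1 then 1 else 0 := by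
  have h1 : ∀ i, (A * krylov A ψ) i j = krylov A ψ i ⟨j + 1, hj⟩ := by
    intro i
    simp only [krylov, Matrix.of_apply, pow_succ', ← Matrix.mulVec_mulVec]
    rfl
  have h2 : ((krylov A ψ)⁻¹ * A * krylov A ψ) k j = ((krylov A ψ)⁻¹ * krylov A ψ) k ⟨j + 1, hj⟩ := by
    rw [Matrix.mul_assoc, Matrix.mul_apply, Matrix.mul_apply]
    exact Finset.sum_congr rfl fun i _ => by rw [h1]
  rw [h2, Matrix.nonsing_inv_mul _ h, Matrix.one_apply]
  exact if_congr Fin.ext_iff rfl rfl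

theorem krylov_inv_mulVec {n : ℕ} (hn : 0 < n) {A : Matrix (Fin n) (Fin n) ℂ} {ψ : Fin n → ℂ}
    (h : IsUnit (krylov A ψ).det) (k : Fin n) :
    (krylov A ψ)⁻¹.mulVec ψ k = if (k : ℕ) = 0 then 1 else 0 := by
  have h1 : (krylov A ψ)⁻¹.mulVec ψ k = ((krylov A ψ)⁻¹ * krylov A ψ) k ⟨0, hn⟩ := by
    rw [Matrix.mul_apply, Matrix.mulVec, dotProduct]
    exact Finset.sum_congr rfl fun i _ => by simp [krylov]
  rw [h1, Matrix.nonsing_inv_mul _ h, Matrix.one_apply]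
  exact if_congr Fin.ext_iff rfl rfl

theorem boundedNearZero_gram_sub {m n : ℕ} (hn : 0 < n) {l : ℝ} (hl : 0 < l)
    {A₁ S₁ : Matrix (Fin m) (Fin m) ℂ} {A₂ : Matrix (Fin n) (Fin n) ℂ} {ψ : Fin n → ℂ}
    {r : Fin m → ℂ} {h : Fin 2 → ℂ} (hh : h ≠ 0) {Ψ₁ : Matrix (Fin m) (Fin 2) ℂ}
    (hS₁ : S₁.det ≠ 0)
    {q0 : ℝ → Matrix (Fin 2) (Fin 2) ℂ} (hq0 : BoundedNearZero q0)
    {P : ℝ → Matrix (Fin m ⊕ Fin n) (Fin 2) ℂ}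
    {S : ℝ → Matrix (Fin m ⊕ Fin n) (Fin m ⊕ Fin n) ℂ}
    (hP : HasACDerivOn (Ico 0 l) P (fun x =>
      Matrix.fromBlocks A₁ 0 (Matrix.vecMulVec ψ r) A₂ * P x * q1 + P x * q0 x))
    (hS : HasACDerivOn (Ico 0 l) S (fun x => P x * (P x).conjTranspose))
    (hP0 : P 0 = Matrix.fromRows Ψ₁ (Matrix.vecMulVec ψ h))
    (hS0 : S 0 = Matrix.fromBlocks S₁ 0 0 0) (hpos : ∀ x ∈ Ioo 0 l, (S x).PosDef) :
    BoundedNearZero fun x => matX P S x - (x : ℂ)⁻¹ •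
      ((leadingMatrix n h).conjTranspose * (cauchyGram (leadingMatrix n h))⁻¹ *
        leadingMatrix n h) := by
  have hT : IsUnit (krylov A₂ ψ).det :=
    isUnit_iff_ne_zero.2 (krylov_det_ne_zero hl hq0 hP hS hP0 hS0 hpos)
  set T := krylov A₂ ψ with hTdef
  set V := leadingMatrix n h with hV
  have hq := boundedNearZero_iff.1 hq0
  let TT : Matrix (Fin m ⊕ Fin n) (Fin m ⊕ Fin n) ℂ := Matrix.fromBlocks 1 0 0 T⁻¹
  have hTT : IsUnit TT.det := by
    rw [Matrix.det_fromBlocks_zero₁₂, Matrix.det_one, one_mul]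
    exact Matrix.isUnit_nonsing_inv_det_iff.2 hT
  let Q : ℝ → Matrix (Fin m ⊕ Fin n) (Fin 2) ℂ := fun x => TT * P x
  let Sh : ℝ → Matrix (Fin m ⊕ Fin n) (Fin m ⊕ Fin n) ℂ := fun x =>
    TT * S x * TT.conjTranspose
  -- `X` is unchanged under `Π ↦ TT Π`, `S ↦ TT S TT*`, so it may be studied in Krylov coordinates.
  have hX : ∀ x, (Q x).conjTranspose * (Sh x)⁻¹ * Q x = matX P S x := by
    intro x
    have hTT' : IsUnit TT.conjTranspose.det := by
      rw [Matrix.det_conjTranspose]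
      exact hTT.star
    simp only [Q, Sh, matX, Matrix.mul_inv_rev, Matrix.conjTranspose_mul, Matrix.mul_assoc]
    rw [Matrix.nonsing_inv_mul_cancel_left _ _ hTT, Matrix.mul_nonsing_inv_cancel_left _ _ hTT']
  have hP1 : ∀ a b, (fun x => P x a b) =O[𝓝[>] 0] fun _ => (1 : ℝ) := fun a b =>
    (hasACDerivOn_iff.1 hP a b).isBigO_one hl
  -- The regular rows.
  have hQl : ∀ (a : Fin m) b, (fun x => Q x (Sum.inl a) b - Ψ₁ a b) =O[𝓝[>] 0]
      fun x : ℝ => x := by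
    intro a b
    have e : ∀ x, Q x (Sum.inl a) b = P x (Sum.inl a) b := fun x => by
      simp [Q, TT, Matrix.mul_apply, Fintype.sum_sum_type, Matrix.one_apply]
    simp only [e]
    have hd := (hasACDerivOn_iff.1 hP (Sum.inl a) b).sub (HasACDeriv.const _ (Ψ₁ a b))
    refine (hd.isBigO (k := 0) hl (by simp [hP0]) ?_).congr_right fun x => by simp
    simp only [Matrix.add_apply, sub_zero, pow_zero]
    exact IsBigO.add (isBigO_entries_mul_one (fun c => isBigO_entries_one_mul
      (fun j => isBigO_const_one _) fun j => hP1 _ _) fun c => isBigO_const_one _)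
      (isBigO_entries_mul_one (fun c => hP1 _ _) fun c => hq _ _)
  -- The singular rows.
  have hP2 : HasACDerivOn (Ico 0 l) (fun x => (P x).toRows₂) fun x =>
      (Matrix.vecMulVec ψ r * (P x).toRows₁ + A₂ * (P x).toRows₂) * q1 + (P x).toRows₂ * q0 x := by
    refine hasACDerivOn_iff.2 fun k b => ?_
    have := hasACDerivOn_iff.1 hP (Sum.inr k) b
    refine this.congr_deriv (fun x _ => ?_) measurableSet_Ico
    have e : Matrix.fromBlocks A₁ 0 (Matrix.vecMulVec ψ r) A₂ * P x =
        Matrix.fromRows (A₁ * (P x).toRows₁)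
          (Matrix.vecMulVec ψ r * (P x).toRows₁ + A₂ * (P x).toRows₂) := by
      conv_lhs => rw [← Matrix.fromRows_toRows (P x)]
      rw [Matrix.fromBlocks_mul_fromRows, Matrix.zero_mul, add_zero]
    rw [e, Matrix.fromRows_mul]
    rfl
  -- Conjugation by `T` makes `A₂` a companion matrix, and `T⁻¹ ψ` is the first basis vector. The
  -- coupling to the regular rows therefore acts on row `0` alone.
  have hQ2 : HasACDerivOn (Ico 0 l) (fun x => T⁻¹ * (P x).toRows₂) fun x =>
      (T⁻¹ * A₂ * T) * (T⁻¹ * (P x).toRows₂) * q1 + (T⁻¹ * (P x).toRows₂) * q0 x +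
        Matrix.vecMulVec (T⁻¹.mulVec ψ) r * (P x).toRows₁ * q1 := by
    refine (hP2.const_mul T⁻¹).congr_deriv (fun x _ => ?_) measurableSet_Ico
    have e : T⁻¹ * Matrix.vecMulVec ψ r = Matrix.vecMulVec (T⁻¹.mulVec ψ) r := by
      rw [Matrix.mul_vecMulVec]
    rw [← e]
    simp only [Matrix.mul_add, Matrix.add_mul, Matrix.mul_assoc,
      Matrix.mul_nonsing_inv_cancel_left _ _ hT]
    abel
  have hinit : ∀ k, (T⁻¹.mulVec ψ) k = if (k : ℕ) = 0 then 1 else 0 := krylov_inv_mulVec hn hT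
  have hrow := isBigO_row_sub_leadingRow (h := h) hl hq (fun k j hj => krylov_companion hT k j hj)
    (E := fun x => Matrix.vecMulVec (T⁻¹.mulVec ψ) r * (P x).toRows₁ * q1)
    (fun k hk x b => by
      rw [Matrix.mul_assoc, Matrix.mul_apply]
      refine Finset.sum_eq_zero fun c _ => ?_
      rw [Matrix.vecMulVec_apply, hinit, if_neg hk.ne', zero_mul, zero_mul])
    (fun k b => isBigO_entries_mul_one (fun c => isBigO_entries_one_mul
      (fun j => isBigO_const_one _) fun j => hP1 (Sum.inl j) c) fun c => isBigO_const_one _)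
    hQ2 (fun k => by
      rw [hP0, Matrix.toRows₂_fromRows, Matrix.mul_vecMulVec]
      ext b
      rw [Matrix.vecMulVec_apply, hinit]
      split_ifs <;> simp)
  have hQO : ∀ a b, (fun x => Q x a b - Matrix.fromRows Ψ₁ V a b * (x : ℂ) ^ rowOrder a)
      =O[𝓝[>] 0] fun x : ℝ => x ^ (rowOrder a + 1) := by
    rintro (a | a) b
    · simpa [rowOrder] using hQl a b
    · refine (hrow a a.2 b).congr_left fun x => ?_
      have : Q x (Sum.inr a) b = (T⁻¹ * (P x).toRows₂) a b := by
        simp only [Q, TT]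
        conv_lhs => rw [← Matrix.fromRows_toRows (P x)]
        rw [Matrix.fromBlocks_mul_fromRows, Matrix.zero_mul, Matrix.zero_mul, zero_add]
        rfl
      rw [this]
      rfl
  have hpowO : ∀ (c : ℂ) (k : ℕ), (fun x : ℝ => c * (x : ℂ) ^ k) =O[𝓝[>] 0] fun x : ℝ => x ^ k :=
    fun c k => (IsBigO.of_bound 1 (Eventually.of_forall fun x => by simp)).const_mul_left c
  have hQO' : ∀ a b, (fun x => Q x a b) =O[𝓝[>] 0] fun x : ℝ => x ^ rowOrder a := fun a b =>
    (((hQO a b).trans (isBigO_pow_pow_nhdsGT (Nat.le_succ _))).add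
      (hpowO (Matrix.fromRows Ψ₁ V a b) _)).congr_left fun x => sub_add_cancel _ _
  have hSh : HasACDerivOn (Ico 0 l) Sh fun x => Q x * (Q x).conjTranspose :=
    ((hS.const_mul TT).mul_const TT.conjTranspose).congr_deriv (fun x _ => by
      simp only [Q, Matrix.conjTranspose_mul, Matrix.mul_assoc]) measurableSet_Ico
  have hSh0 : Sh 0 = Matrix.fromBlocks S₁ 0 0 0 := by
    simp only [Sh, TT, hS0, Matrix.fromBlocks_conjTranspose, Matrix.fromBlocks_multiply]
    simp
  have hShO : ∀ a b, (fun x => Sh x a b - Matrix.fromBlocks S₁ 0 0 0 a b -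
        (Matrix.fromRows Ψ₁ V * (Matrix.fromRows Ψ₁ V).conjTranspose) a b *
          (x : ℂ) ^ (rowOrder a + rowOrder b + 1) / ((rowOrder a + rowOrder b : ℕ) + 1))
      =O[𝓝[>] 0] fun x : ℝ => x ^ (rowOrder a + rowOrder b + 2) := by
    intro a b
    have hd := (hasACDerivOn_iff.1 hSh a b).sub
      (HasACDeriv.const _ (Matrix.fromBlocks S₁ 0 0 0 a b))
    refine hd.isBigO_sub hl (by rw [hSh0, sub_self]) ?_
    -- The product error is split as `(a - a₀) b* + a₀ (b - b₀)*`.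
    have e : ∀ x : ℝ, (Q x * (Q x).conjTranspose) a b - 0 -
        (Matrix.fromRows Ψ₁ V * (Matrix.fromRows Ψ₁ V).conjTranspose) a b *
          (x : ℂ) ^ (rowOrder a + rowOrder b) =
        ∑ c, ((Q x a c - Matrix.fromRows Ψ₁ V a c * (x : ℂ) ^ rowOrder a) * star (Q x b c) +
          Matrix.fromRows Ψ₁ V a c * (x : ℂ) ^ rowOrder a *
            star (Q x b c - Matrix.fromRows Ψ₁ V b c * (x : ℂ) ^ rowOrder b)) := by
      intro x
      rw [sub_zero, Matrix.mul_apply, Matrix.mul_apply, Finset.sum_mul, ← Finset.sum_sub_distrib]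
      refine Finset.sum_congr rfl fun c _ => ?_
      have hs : star ((x : ℂ) ^ rowOrder b) = (x : ℂ) ^ rowOrder b := by simp
      rw [Matrix.conjTranspose_apply, Matrix.conjTranspose_apply, star_sub, star_mul', hs]
      ring
    simp only [e]
    have hstar : ∀ {f : ℝ → ℂ} {g : ℝ → ℝ}, f =O[𝓝[>] 0] g →
        (fun x => star (f x)) =O[𝓝[>] 0] g :=
      fun hf => (hf.norm_left.congr_left fun x => (norm_star _).symm).of_norm_left
    refine IsBigO.fun_sum fun c _ => IsBigO.add ?_ ?_
    · exact ((hQO a c).mul (hstar (hQO' b c))).congr_right fun x => by ring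
    · exact ((hpowO _ _).mul (hstar (hQO b c))).congr_right fun x => by ring
  have hdet : ∀ᶠ x in 𝓝[>] (0 : ℝ), (Sh x).det ≠ 0 := by
    filter_upwards [Ioo_mem_nhdsGT hl] with x hx
    simp only [Sh, Matrix.det_mul, Matrix.det_conjTranspose]
    exact mul_ne_zero (mul_ne_zero hTT.ne_zero (hpos x hx).det_pos.ne') hTT.star.ne_zero
  have hfin := isBigO_mul_gram_sub hQO hShO hdet hS₁
    (cauchyGram_det_ne_zero fun k => leadingRow_ne_zero hh k)
  refine boundedNearZero_iff.2 fun i j => ?_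
  have h1 : (fun x : ℝ => (x : ℂ)⁻¹) =O[𝓝[>] 0] fun x : ℝ => x⁻¹ :=
    IsBigO.of_bound 1 (Eventually.of_forall fun x => by simp)
  refine (h1.mul (hfin i j)).congr' ?_ ?_
  · filter_upwards [self_mem_nhdsWithin] with x hx
    have hx0 : (x : ℂ) ≠ 0 := by exact_mod_cast ne_of_gt hx
    rw [hX, mul_sub, inv_mul_cancel_left₀ hx0]
    rfl
  · filter_upwards [self_mem_nhdsWithin] with x hx
    exact inv_mul_cancel₀ (ne_of_gt hx)

theorem boundedNearZero_transformedQ0_sub {α : Type*} [Fintype α] [DecidableEq α]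
    {q0 : ℝ → Matrix (Fin 2) (Fin 2) ℂ} (hq0 : BoundedNearZero q0)
    {P : ℝ → Matrix α (Fin 2) ℂ} {S : ℝ → Matrix α α ℂ} {M : Matrix (Fin 2) (Fin 2) ℂ}
    (hX : BoundedNearZero fun x => matX P S x - (x : ℂ)⁻¹ • M) {κ : ℂ}
    (hM : brevJ * M * brevJ.conjTranspose - M = κ • pauli3) :
    BoundedNearZero fun x => transformedQ0 q0 P S x - (κ / (x : ℂ)) • pauli3 := by
  rw [boundedNearZero_iff] at hq0 hX ⊢
  intro i j
  have e : ∀ x : ℝ, transformedQ0 q0 P S x - (κ / (x : ℂ)) • pauli3 =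
      q0 x + (brevJ * ((matX P S x - (x : ℂ)⁻¹ • M) * brevJ.conjTranspose) -
        (matX P S x - (x : ℂ)⁻¹ • M)) := by
    intro x
    rw [div_eq_inv_mul, ← smul_smul, ← hM, transformedQ0]
    simp only [Matrix.mul_sub, Matrix.sub_mul, smul_sub, Matrix.mul_smul, Matrix.smul_mul,
      Matrix.mul_assoc]
    abel
  simp only [e, Matrix.add_apply, Matrix.sub_apply (brevJ * _)]
  exact (hq0 i j).add ((isBigO_entries_one_mul (fun k => isBigO_const_one _) fun k =>
    isBigO_entries_mul_one (fun c => hX k c) fun c => isBigO_const_one _).sub (hX i j))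

/-- If `Ψ J Ψ* = 0` and some row of `Ψ` is a nonzero multiple of a coordinate vector, then all rows
are multiples of that vector. -/
theorem exists_eq_vecMulVec {n : ℕ} {Ψ : Matrix (Fin n) (Fin 2) ℂ}
    (hΨ : Ψ * brevJ * Ψ.conjTranspose = 0) {c : ℂ} (hc : c ≠ 0) {k : Fin n} :
    (Ψ k = ![c, 0] → ∃ ψ, Ψ = Matrix.vecMulVec ψ ![1, 0]) ∧
      (Ψ k = ![0, c] → ∃ ψ, Ψ = Matrix.vecMulVec ψ ![0, 1]) := by
  have h1 : ∀ i, Ψ i 0 * star (Ψ k 1) - Ψ i 1 * star (Ψ k 0) = 0 := by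
    intro i
    have := congrFun (congrFun hΨ i) k
    rw [Matrix.mul_apply, Fin.sum_univ_two, Matrix.mul_apply, Matrix.mul_apply, Fin.sum_univ_two,
      Fin.sum_univ_two] at this
    simp [brevJ] at this
    simp only [Complex.star_def]
    linear_combination this
  have hc' : star c ≠ 0 := star_ne_zero.2 hc
  constructor
  · intro hk
    refine ⟨fun i => Ψ i 0, ?_⟩
    ext i b
    have := h1 i
    rw [hk] at this
    fin_cases b
    · simp [Matrix.vecMulVec_apply]
    · simpa [Matrix.vecMulVec_apply, hc] using this
  · intro hk
    refine ⟨fun i => Ψ i 1, ?_⟩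
    ext i b
    have := h1 i
    rw [hk] at this
    fin_cases b
    · simpa [Matrix.vecMulVec_apply, hc] using this
    · simp [Matrix.vecMulVec_apply]

end RadialDirac

/-! ### Assembly of the two claims -/

theorem theorem4p3
    -- the initial system on `(0, l)`
    (l : ℝ) (hl : 0 < l) (κ₀ : ℤ) (va ve vs : ℝ → ℝ)
    (hva : MeasureTheory.LocallyIntegrableOn va (Set.Ico 0 l))
    (hve : MeasureTheory.LocallyIntegrableOn ve (Set.Ico 0 l))
    (hvs : MeasureTheory.LocallyIntegrableOn vs (Set.Ico 0 l))
    (hq0 : RadialDirac.BoundedNearZero (RadialDirac.diracQ0 κ₀ va ve vs))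
    -- the parameter matrices
    (m n : ℕ) (hn : 0 < n)
    (A₁ S₁ : Matrix (Fin m) (Fin m) ℂ) (A₂ : Matrix (Fin n) (Fin n) ℂ)
    (Ψ₁ : Matrix (Fin m) (Fin 2) ℂ) (Ψ₂ : Matrix (Fin n) (Fin 2) ℂ)
    (R : Matrix (Fin n) (Fin m) ℂ) (A : Matrix (Fin m ⊕ Fin n) (Fin m ⊕ Fin n) ℂ)
    (hA₂ : ∀ i j : Fin n, i < j → A₂ i j = 0)
    (hS₁ : S₁.PosDef)
    (hR : R = Ψ₂ * RadialDirac.brevJ * Ψ₁.conjTranspose * S₁⁻¹)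
    (hA : A = Matrix.fromBlocks A₁ 0 R A₂)
    (hΨ₁ : A₁ * S₁ - S₁ * A₁.conjTranspose = Ψ₁ * RadialDirac.brevJ * Ψ₁.conjTranspose)
    (hΨ₂ : Ψ₂ * RadialDirac.brevJ * Ψ₂.conjTranspose = 0)
    (c : ℂ) (hc : c ≠ 0)
    (hh : Ψ₂ ⟨0, hn⟩ = ![c, 0] ∨ Ψ₂ ⟨0, hn⟩ = ![0, c])
    -- the matrix functions `Π` and `S`
    (P : ℝ → Matrix (Fin m ⊕ Fin n) (Fin 2) ℂ)
    (S : ℝ → Matrix (Fin m ⊕ Fin n) (Fin m ⊕ Fin n) ℂ)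
    (hP0 : P 0 = Matrix.fromRows Ψ₁ Ψ₂)
    (hP : RadialDirac.HasACDerivOn (Set.Ico 0 l) P
      (fun x => A * P x * RadialDirac.q1 + P x * RadialDirac.diracQ0 κ₀ va ve vs x))
    (hS0 : S 0 = Matrix.fromBlocks S₁ 0 0 0)
    (hS : RadialDirac.HasACDerivOn (Set.Ico 0 l) S (fun x => P x * (P x).conjTranspose))
    (hSpos : ∀ x ∈ Set.Ioo 0 l, (S x).PosDef) :
    (∀ lam : ℂ, lam ∉ spectrum ℂ A → lam ∉ spectrum ℂ A.conjTranspose →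
      ∀ u : ℝ → Matrix (Fin 2) (Fin 2) ℂ,
        RadialDirac.IsFundamentalSolution l (RadialDirac.diracQ0 κ₀ va ve vs) lam u →
        RadialDirac.IsFundamentalSolution l
          (RadialDirac.transformedQ0 (RadialDirac.diracQ0 κ₀ va ve vs) P S) lam
          (fun x => RadialDirac.transferW A P S lam x * u x)) ∧
    ∃ κ : ℤ,
      ((Odd n ∧ Ψ₂ ⟨0, hn⟩ = ![0, c]) ∨ (Even n ∧ Ψ₂ ⟨0, hn⟩ = ![c, 0]) → κ = (n : ℤ)) ∧
      ((Even n ∧ Ψ₂ ⟨0, hn⟩ = ![0, c]) ∨ (Odd n ∧ Ψ₂ ⟨0, hn⟩ = ![c, 0]) → κ = -(n : ℤ)) ∧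
      RadialDirac.BoundedNearZero (fun x =>
        RadialDirac.transformedQ0 (RadialDirac.diracQ0 κ₀ va ve vs) P S x
          - ((κ : ℂ) / (x : ℂ)) • RadialDirac.pauli3) := by
  classical
  have hS₁u : IsUnit S₁.det := isUnit_iff_ne_zero.2 hS₁.det_pos.ne'
  have hq : ∀ x, RadialDirac.brevJ * (RadialDirac.diracQ0 κ₀ va ve vs x).conjTranspose =
      -(RadialDirac.diracQ0 κ₀ va ve vs x * RadialDirac.brevJ) :=
    RadialDirac.brevJ_mul_diracQ0_conjTranspose κ₀ va ve vs
  refine ⟨fun lam h1 h2 u hu => ?_, ?_⟩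
  · have h0 : A * S 0 - S 0 * A.conjTranspose =
        P 0 * RadialDirac.brevJ * (P 0).conjTranspose := by
      rw [hA, hR, hS0, hP0]
      exact RadialDirac.operator_identity_init hS₁u hS₁.isHermitian hΨ₁ hΨ₂
    exact RadialDirac.isFundamentalSolution_transferW hq (hP.mono Set.Ioo_subset_Ico_self)
      (hS.mono Set.Ioo_subset_Ico_self) (fun x hx => (hSpos x hx).det_pos.ne')
      (fun x hx => RadialDirac.operator_identity hl hq hP hS h0 (Set.Ioo_subset_Ico_self hx))
      h1 h2 hu
  -- Here `h` is a normalised coordinate row: the constant `c` is absorbed into `ψ`. The sign `s` is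
  -- the eigenvalue of `σ₃` on `h`, namely `1` for `[1 0]` and `-1` for `[0 1]`.
  · have main : ∀ (h : Fin 2 → ℂ) (s : ℤ), h ≠ 0 → (s = 1 ∨ s = -1) →
        Matrix.vecMul h RadialDirac.pauli3 = (s : ℂ) • h →
        (∃ ψ, Ψ₂ = Matrix.vecMulVec ψ h) →
        RadialDirac.BoundedNearZero (fun x =>
          RadialDirac.transformedQ0 (RadialDirac.diracQ0 κ₀ va ve vs) P S x
            - (((s * (-1) ^ n * n : ℤ) : ℂ) / (x : ℂ)) • RadialDirac.pauli3) := by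
      rintro h s hnz hs hhs ⟨ψ, rfl⟩
      have hR' : R = Matrix.vecMulVec ψ (Matrix.vecMul h
          (RadialDirac.brevJ * Ψ₁.conjTranspose * S₁⁻¹)) := by
        rw [hR, ← Matrix.vecMulVec_mul]
        simp only [Matrix.mul_assoc]
      rw [hA, hR'] at hP
      refine RadialDirac.boundedNearZero_transformedQ0_sub hq0
        (RadialDirac.boundedNearZero_gram_sub hn hl hnz hS₁u.ne_zero hq0 hP hS hP0 hS0 hSpos) ?_
      push_cast
      refine RadialDirac.brevJ_conj_sub_of_gram ?_
        (fun k => RadialDirac.leadingRow_ne_zero hnz k)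
        (fun k => RadialDirac.leadingRow_vecMul_pauli3 hhs k)
      exact_mod_cast hs
    have hne : (![c, 0] : Fin 2 → ℂ) ≠ ![0, c] := fun h => hc (by simpa using congrFun h 0)
    rcases hh with hh | hh
    · refine ⟨1 * (-1) ^ n * n, ?_, ?_, main ![1, 0] 1 (fun h => by simpa using congrFun h 0)
        (Or.inl rfl) ?_ ((RadialDirac.exists_eq_vecMulVec hΨ₂ hc).1 hh)⟩
      · rintro (⟨_, h⟩ | ⟨h, _⟩)
        · exact absurd (hh.symm.trans h) hne
        · rw [h.neg_one_pow]; ring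
      · rintro (⟨_, h⟩ | ⟨h, _⟩)
        · exact absurd (hh.symm.trans h) hne
        · rw [h.neg_one_pow]; ring
      · ext b
        fin_cases b <;> simp [RadialDirac.pauli3]
    · refine ⟨-1 * (-1) ^ n * n, ?_, ?_, main ![0, 1] (-1) (fun h => by simpa using congrFun h 1)
        (Or.inr rfl) ?_ ((RadialDirac.exists_eq_vecMulVec hΨ₂ hc).2 hh)⟩
      · rintro (⟨h, _⟩ | ⟨_, h⟩)
        · rw [h.neg_one_pow]; ring
        · exact absurd (h.symm.trans hh) hne
      · rintro (⟨h, _⟩ | ⟨_, h⟩)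
        · rw [h.neg_one_pow]; ring
        · exact absurd (h.symm.trans hh) hne
      · ext b
        fin_cases b <;> simp [RadialDirac.pauli3]
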